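/- **Setting.** An infinite labeled line is a connected $2$-regular graph $G=(V,E)$ on a countably infinite vertex set together with an injective labeling $\ell:V\to\{1,2,3,\dots\}$. Distances are measured in $G$; $N^k(S)$ is the set of vertices at distance at most $k$ from $S$; $G^k$ joins distinct vertices at distance at most $k$; $G^k[U]$ is the subgraph of $G^k$ induced by $U$. Let $\log$ be the base-$2$ logarithm, $\log^*x=1$ for $x\le 1$ and $\log^*x=1+\log^*(\log x)$ for $x>1$, and $V_i=\{v:\log^*\ell(v)=i\}$ for $i\ge 1$. A set $S$ is a $U$-limited $(\alpha,\beta)$-ruling set of $G$ if $S\subseteq U$, any two distinct vertices of $S$ are at distance at least $\alpha$, and every vertex of $U$ is at distance at most $\beta$ from $S$. Let $R\ge 1$ be an integer. A *greedy step* on $(U,S)$ puts $b_v=\mathrm{dist}(v,S)$ and $C=\{v\in U: b_v\ge R\}$, and adds to $S$ all $v\in C$ such that every $u\in C\setminus\{v\}$ with $\mathrm{dist}(u,v)\le R-1$ satisfies $b_u<b_v$, or $b_u=b_v$ and $\ell(u)<\ell(v)$. *PathRulingSet* on a finite set $U$: let $d=\lceil\log R\rceil$ and $M_0=U$; for $i=1,\dots,d$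 let $M_i$ be a maximal independent set of $G^{R_i}[M_{i-1}]$, where $R_i=2^i-1$ for $i\le d-1$ and $R_d=R-1$; then perform $6$ greedy steps on $(U,M_d)$ and return the resulting set. *ES-ColPathRulingSet$(R)$* starts with $S=\emptyset$ and treats $V_1,V_2,\dots$ as follows. For $V_i$, compute a result $P_i$ of PathRulingSet on $V_i$; after all vertices of $V_1,\dots,V_{i-1}$ have terminated, let $S_{<i}$ be the current $S$, replace $S$ by $S_{<i}\cup(P_i\setminus N^{R-1}(S_{<i}))$, and perform $4$ greedy steps on $(V_i,S)$. Color the vertices of $S\setminus S_{<i}$ by a list coloring $\chi$ of $G^{9R-1}[S\setminus S_{<i}]$, where the list of $u$ is $[17]\setminus\{\chi(w):w\in S_{<i}\cap N^{9R-1}(u)\}$. Finally all vertices $v\in V_i$ terminate in a common round, and $v$ outputs whether $v\in S$, its color if so, and the labels and colors of the members of $S$ at distance less than $R$ from $v$. The maximal independent sets and list colorings are computed by deterministic subroutines of the LOCAL model (synchronous rounds, unbounded messages and local computation, each node initially knowing only its own label). **Lemma.** 1. There is a universal constant $\kappa$ such that, for suitable subroutines and waiting times, for every $R\ge1$, ES-ColPathRulingSet$(R)$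 is a deterministic LOCAL algorithm in which, on every infinite labeled line, every node $v$ terminates within $\kappa R\log^*\ell(v)$ rounds. 2. Consider any run of ES-ColPathRulingSet$(R)$ on an infinite labeled line, whatever maximal independent sets, list colorings and waiting times are used. For a round $T$ let $U_T$ be the set of nodes that have terminated up to round $T$, $S_T\subseteq U_T$ the set of those that output that they joined $S$, and $\chi_T:S_T\to[17]$ the colors that they output. Then, for every $T$, $S_T$ is a $U_T$-limited $(R,R-1)$-ruling set of $G$, and $\chi_T$ is a proper coloring of $G^{9R-1}[S_T]$. Moreover, every node $v$ that terminates in round $T$ outputs exactly the labels and colors under $\chi_T$ of the nodes $u\in S_T$ with $\mathrm{dist}(u,v)<R$. -/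

import Mathlib

open scoped ENat

universe u

/-! ### The iterated logarithm, with the convention `log* x ≥ 1` -/

theorem ceil_logb_two_lt {x : ℝ} (hx : 1 < x) : ⌈Real.logb 2 x⌉₊ < ⌈x⌉₊ := by
  have h1 : 1 < ⌈x⌉₊ := Nat.lt_ceil.mpr (by simpa using hx)
  have hle : x ≤ (⌈x⌉₊ : ℝ) := Nat.le_ceil x
  obtain ⟨m, hm⟩ : ∃ m, ⌈x⌉₊ = m + 1 := ⟨⌈x⌉₊ - 1, by omega⟩
  have hpow : (⌈x⌉₊ : ℝ) ≤ (2 : ℝ) ^ m := by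
    have : m + 1 ≤ 2 ^ m := Nat.lt_two_pow_self
    rw [hm]; exact_mod_cast this
  have hlog : Real.logb 2 x ≤ (m : ℝ) := by
    rw [Real.logb_le_iff_le_rpow (by norm_num) (by linarith), Real.rpow_natCast]
    exact hle.trans hpow
  have : ⌈Real.logb 2 x⌉₊ ≤ m := Nat.ceil_le.mpr hlog
  omega

/-- `log* x = 1` if `x ≤ 1`, and `log* x = 1 + log* (log₂ x)` otherwise. -/
noncomputable def logStar (x : ℝ) : ℕ :=
  if h : x ≤ 1 then 1 else 1 + logStar (Real.logb 2 x)
termination_by ⌈x⌉₊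
decreasing_by exact ceil_logb_two_lt (not_le.mp h)

/-! ### Graph notions -/

section Graphs

variable {V : Type*}

/-- An infinite line: a connected 2-regular graph on a countably infinite vertex set. -/
structure IsInfiniteLine (G : SimpleGraph V) [G.LocallyFinite] : Prop where
  countable : Countable V
  infinite : Infinite V
  connected : G.Connected
  regular : G.IsRegularOfDegree 2

/-- Unique labels in the positive integers. -/
structure IsLabeling (ℓ : V → ℕ) : Prop where
  pos : ∀ v, 1 ≤ ℓ v
  injective : Function.Injective ℓ

/-- The power graph `G ^ k`: distinct vertices at distance at most `k` in `G` are adjacent. -/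
def powerGraph (G : SimpleGraph V) (k : ℕ) : SimpleGraph V where
  Adj u v := u ≠ v ∧ G.edist u v ≤ k
  symm := ⟨fun u v h => ⟨h.1.symm, by rw [SimpleGraph.edist_comm]; exact h.2⟩⟩
  loopless := ⟨fun _ h => h.1 rfl⟩

/-- `N^k(S)`: the vertices at distance at most `k` from some vertex of `S`. -/
def neighborhood (G : SimpleGraph V) (k : ℕ) (S : Set V) : Set V :=
  {v | ∃ u ∈ S, G.edist v u ≤ k}

/-- `S` is a `U`-limited `(α, β)`-ruling set of `G`; distances are measured in `G`. -/
structure IsLimitedRulingSet (G : SimpleGraph V) (U S : Set V) (α β : ℕ) : Prop where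
  subset : S ⊆ U
  packing : ∀ u ∈ S, ∀ v ∈ S, u ≠ v → (α : ℕ∞) ≤ G.edist u v
  covering : ∀ u ∈ U, ∃ v ∈ S, G.edist u v ≤ β

/-- `S` is a maximal independent set (independent and dominating) of the induced graph `H[U]`. -/
structure IsMISOn (H : SimpleGraph V) (U S : Set V) : Prop where
  subset : S ⊆ U
  independent : ∀ u ∈ S, ∀ v ∈ S, ¬ H.Adj u v
  dominating : ∀ u ∈ U, u ∉ S → ∃ v ∈ S, H.Adj u v

/-- The restriction of `χ` to `U` is a list coloring of the induced graph `H[U]` for the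
lists `ψ`. -/
structure IsListColoringOn {C : Type*} (H : SimpleGraph V) (U : Set V) (ψ : V → Set C)
    (χ : V → C) : Prop where
  mem_list : ∀ u ∈ U, χ u ∈ ψ u
  proper : ∀ u ∈ U, ∀ v ∈ U, H.Adj u v → χ u ≠ χ v

/-- The distance `b_v` from `v` to the set `S` (`⊤` if `S` is empty). -/
noncomputable def distToSet (G : SimpleGraph V) (S : Set V) (v : V) : ℕ∞ :=
  ⨅ u ∈ S, G.edist v u

/-- `U_cand`: the vertices of `U` at distance at least `R` from `S`. -/
def candidates (G : SimpleGraph V) (U : Set V) (R : ℕ) (S : Set V) : Set V :=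
  {v ∈ U | (R : ℕ∞) ≤ distToSet G S v}

/-- One iteration of the greedy extension: all candidates join `S` that beat every other
candidate within distance `R - 1`, in the lexicographic order of distance to `S` and label. -/
def greedyStep (G : SimpleGraph V) (ℓ : V → ℕ) (U : Set V) (R : ℕ) (S : Set V) : Set V :=
  S ∪ {v ∈ candidates G U R S | ∀ u ∈ candidates G U R S, u ≠ v →
    G.edist v u ≤ ((R - 1 : ℕ) : ℕ∞) →
      distToSet G S u < distToSet G S v ∨
        (distToSet G S u = distToSet G S v ∧ ℓ u < ℓ v)}

/-- `V_i`: the vertices whose label has iterated logarithm `i`. -/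
def labelClass (ℓ : V → ℕ) (i : ℕ) : Set V := {v | logStar (ℓ v) = i}

/-! ### The procedure `PathRulingSet` -/

/-- The radius `R_i` used in iteration `i`, where `⌈log₂ R⌉` is the number of iterations. -/
def misRadius (R i : ℕ) : ℕ := if i + 1 ≤ Nat.clog 2 R then 2 ^ i - 1 else R - 1

/-- `S_out` is a possible result of `PathRulingSet` on the set `U` with distance `R`: for
`i = 1, …, d` with `d = ⌈log₂ R⌉`, `M i` is some maximal independent set of
`G^{R_i}[M (i - 1)]`, where `M 0 = U`, and `S_out` is obtained from `M d` by six greedy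
iterations. -/
def IsPathRulingSetResult (G : SimpleGraph V) (ℓ : V → ℕ) (U : Set V) (R : ℕ)
    (Sout : Set V) : Prop :=
  ∃ M : ℕ → Set V, M 0 = U ∧
    (∀ i, 1 ≤ i → i ≤ Nat.clog 2 R →
      IsMISOn (powerGraph G (misRadius R i)) (M (i - 1)) (M i)) ∧
    Sout = (greedyStep G ℓ U R)^[6] (M (Nat.clog 2 R))

/-! ### The procedure `ES-ColPathRulingSet` -/

/-- The sets and colors computed by `ES-ColPathRulingSet(R)`: `S i` is the value of the variable
`S` after the vertices of `V_1, …, V_i` have been treated, and `χ` records the color that each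
vertex receives when it joins `S` (its values at other vertices are irrelevant). -/
structure IsESColTrace (G : SimpleGraph V) (ℓ : V → ℕ) (R : ℕ) (S : ℕ → Set V)
    (χ : V → Fin 17) : Prop where
  start : S 0 = ∅
  extend : ∀ i, 1 ≤ i → ∃ P : Set V,
    IsPathRulingSetResult G ℓ (labelClass ℓ i) R P ∧
    S i = (greedyStep G ℓ (labelClass ℓ i) R)^[4]
      (S (i - 1) ∪ (P \ neighborhood G (R - 1) (S (i - 1))))
  color : ∀ i, 1 ≤ i →
    IsListColoringOn (powerGraph G (9 * R - 1)) (S i \ S (i - 1))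
      (fun u => {c | ∀ w ∈ S (i - 1) ∩ neighborhood G (9 * R - 1) {u}, c ≠ χ w}) χ

/-- What a vertex outputs: `color = some c` says that it is in the ruling set, with color `c`,
and `color = none` that it is not; `nearby` is the set of labels, with colors, of the known
members of the ruling set near the vertex. -/
structure NodeOutput where
  color : Option (Fin 17)
  nearby : Set (ℕ × Fin 17)

open Classical in
/-- The output that `v` commits to when the ruling set is `S` with coloring `χ`. -/
noncomputable def committedOutput (G : SimpleGraph V) (ℓ : V → ℕ) (R : ℕ) (S : Set V)
    (χ : V → Fin 17) (v : V) : NodeOutput where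
  color := if v ∈ S then some (χ v) else none
  nearby := {p | ∃ u ∈ S, G.edist v u ≤ ((R - 1 : ℕ) : ℕ∞) ∧ p = (ℓ u, χ u)}

/-- `out t v` is what `v` has output up to round `t` (`none` before `v` terminates).  This is a
run of `ES-ColPathRulingSet(R)` with schedule `T` if all vertices of `V_i` commit in round `T i`,
after the vertices of `V_1, …, V_{i-1}` have done so, to the output that the procedure
prescribes. -/
def IsESColRun (G : SimpleGraph V) (ℓ : V → ℕ) (R : ℕ) (T : ℕ → ℕ)
    (out : ℕ → V → Option NodeOutput) : Prop :=
  StrictMono T ∧ ∃ (S : ℕ → Set V) (χ : V → Fin 17), IsESColTrace G ℓ R S χ ∧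
    ∀ t v, out t v =
      if T (logStar (ℓ v)) ≤ t then some (committedOutput G ℓ R (S (logStar (ℓ v))) χ v)
      else none

/-! ### Reading off a run -/

/-- `U_T`: the vertices that have terminated up to round `T`. -/
def terminatedSet (out : ℕ → V → Option NodeOutput) (T : ℕ) : Set V :=
  {v | (out T v).isSome}

/-- `χ_T`, as a partial function: the color output by `v` up to round `T`, if any. -/
def colorAt (out : ℕ → V → Option NodeOutput) (T : ℕ) (v : V) : Option (Fin 17) :=
  (out T v).bind NodeOutput.color

/-- `S_T`: the vertices that have terminated up to round `T` and joined the ruling set. -/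
def joinedSet (out : ℕ → V → Option NodeOutput) (T : ℕ) : Set V :=
  {v | (colorAt out T v).isSome}

/-- `T` is the round in which `v` terminates. -/
def TerminatesInRound (out : ℕ → V → Option NodeOutput) (v : V) (T : ℕ) : Prop :=
  v ∈ terminatedSet out T ∧ ∀ t < T, v ∉ terminatedSet out t

end Graphs

/-! ### The LOCAL model with early stopping -/

/-- A deterministic algorithm of the synchronous LOCAL model.  A node knows its own label at the
start; in each round it sends a message to all its neighbors, receives theirs, and updates its
state.  Messages and local computation are unbounded.  Once a node has produced an output, it is
committed to it, but it may still forward messages.  Sending the same message to all neighbors and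
not knowing from which port a message came only restricts the algorithm. -/
structure LocalAlgorithm (Out : Type) where
  State : Type
  Msg : Type
  init : ℕ → State
  send : State → Msg
  step : State → Multiset Msg → State
  output : State → Option Out
  commit : ∀ s m o, output s = some o → output (step s m) = some o

namespace LocalAlgorithm

variable {V : Type*} {Out : Type}

/-- The state of each node after `t` rounds. -/
def state (A : LocalAlgorithm Out) (G : SimpleGraph V) [G.LocallyFinite] (ℓ : V → ℕ) :
    ℕ → V → A.State
  | 0, v => A.init (ℓ v)
  | t + 1, v => A.step (A.state G ℓ t v)
      ((G.neighborFinset v).val.map fun u => A.send (A.state G ℓ t u))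

/-- The output, if any, of each node after `t` rounds. -/
def run (A : LocalAlgorithm Out) (G : SimpleGraph V) [G.LocallyFinite] (ℓ : V → ℕ)
    (t : ℕ) (v : V) : Option Out :=
  A.output (A.state G ℓ t v)

end LocalAlgorithm

/-! Correctness is a packing argument in a coordinate of the line. The set present before a series
of greedy steps cuts the line into gaps. While a gap contains a candidate, its lexicographically
largest candidate joins: a rival within distance `R - 1` lies in the same gap, because both keep
distance `R` from the points that bound it. Suppose all of `U` starts within distance less than `3
R` of the set. A vertex uncovered after four steps would give five points of its gap, pairwise at
distance at least `R`; three of them would be close to the same side of the gap, where there is room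
for only two (`greedyStep_iterate_covering`). The `3 R` hypothesis holds after the independent sets
(`misRadiusSum_lt`) and after merging (`merge_covering`). Since a vertex can join only while its own
class is treated (`IsSetTrace.mem_of_mem`), the outputs visible in a round form the set after the
last committed class.

For the running time, every set and color is shown to depend only on a ball around a label
(`IsLocal`). The doubling radii keep the power graphs at degree at most 2, so iterated color
reduction yields the independent sets on class `i` with total radius `O(R i)`. The crucial point is
that PathRulingSet on class `i`, and a coloring of its result with constantly many colors, do not
refer to earlier classes. Only merging and coloring the new vertices do, and these add `O(R)` per
class: each new vertex inherits a priority from a nearby ruler, so constantly many rounds of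
choosing a free color suffice (`priority_ne`, `extendColor_ne`). A free color exists because an
`R`-separated set has at most 16 other points within distance `9 R - 1`. The radius obeys `r (i + 1)
= max (r i) (O(R i)) + O(R)` and stays linear in `i` (`es_isLocal`). A node collects its ball and
evaluates the procedure on any labeled line with the same view; locality makes the choice
irrelevant. -/

/-! ### Extended distances bounded by natural numbers, via walks. -/

section EdistBalls

variable {V : Type*} {G : SimpleGraph V}

theorem edist_le_natCast_iff {u w : V} {n : ℕ} :
    G.edist u w ≤ n ↔ ∃ p : G.Walk u w, p.length ≤ n := by
  constructor
  · intro h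
    have hr : G.Reachable u w := by
      rw [← SimpleGraph.edist_ne_top_iff_reachable]
      exact ne_top_of_le_ne_top (ENat.natCast_ne_top n) h
    obtain ⟨p, hp⟩ := hr.exists_walk_length_eq_edist
    exact ⟨p, by rw [← hp] at h; exact_mod_cast h⟩
  · rintro ⟨p, hp⟩
    exact p.edist_le.trans (by exact_mod_cast hp)

theorem edist_le_succ_iff {u w : V} {n : ℕ} :
    G.edist u w ≤ (n + 1 : ℕ) ↔ u = w ∨ ∃ y, G.Adj u y ∧ G.edist y w ≤ n := by
  constructor
  · intro h
    obtain ⟨p, hp⟩ := edist_le_natCast_iff.mp h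
    cases p with
    | nil => exact Or.inl rfl
    | cons h q =>
      refine Or.inr ⟨_, h, edist_le_natCast_iff.mpr ⟨q, ?_⟩⟩
      simp only [SimpleGraph.Walk.length_cons] at hp
      omega
  · rintro (rfl | ⟨y, hy, h⟩)
    · simp
    · obtain ⟨p, hp⟩ := edist_le_natCast_iff.mp h
      exact edist_le_natCast_iff.mpr ⟨.cons hy p, by simpa using hp⟩

theorem edist_le_succ_iff' {u w : V} {n : ℕ} :
    G.edist u w ≤ (n + 1 : ℕ) ↔ u = w ∨ ∃ y, G.edist u y ≤ n ∧ G.Adj y w := by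
  rw [SimpleGraph.edist_comm, edist_le_succ_iff]
  simp only [SimpleGraph.edist_comm, SimpleGraph.adj_comm, and_comm, eq_comm]

theorem edist_le_add {a b c : V} {m n : ℕ} (h : G.edist a b ≤ m) (h' : G.edist b c ≤ n) :
    G.edist a c ≤ (m + n : ℕ) :=
  SimpleGraph.edist_triangle.trans (by push_cast; exact add_le_add h h')

theorem edist_lt_iff_le_pred {a b : V} {R : ℕ} (hR : 1 ≤ R) :
    G.edist a b < R ↔ G.edist a b ≤ ((R - 1 : ℕ) : ℕ∞) := by
  have h : ((R - 1 : ℕ) : ℕ∞) + 1 = R := by exact_mod_cast Nat.sub_add_cancel hR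
  rw [← h, ENat.lt_add_one_iff (ENat.natCast_ne_top _)]

end EdistBalls

/-! ### Coordinates on the line and packing bounds. -/

section LineMetric

variable {V : Type*} {G : SimpleGraph V}

/-- Every component of `G` is isometric to a set of integers. -/
def LineMetric (G : SimpleGraph V) : Prop :=
  ∀ v, ∃ pos : V → ℤ, ∀ x y, G.edist v x ≠ ⊤ → G.edist v y ≠ ⊤ →
    G.edist x y = ((pos x - pos y).natAbs : ℕ)

theorem exists_unique_other [G.LocallyFinite] (hreg : G.IsRegularOfDegree 2) {v u : V}
    (h : G.Adj v u) : ∃ w, G.Adj v w ∧ w ≠ u ∧ ∀ x, G.Adj v x → x = u ∨ x = w := by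
  classical
  have hc : (G.neighborFinset v).card = 2 := hreg v
  obtain ⟨a, b, hab, he⟩ := Finset.card_eq_two.mp hc
  have hm : ∀ x, G.Adj v x ↔ x = a ∨ x = b := by
    intro x
    rw [← SimpleGraph.mem_neighborFinset, he]; simp
  rcases (hm u).mp h with rfl | rfl
  · exact ⟨b, (hm b).mpr (Or.inr rfl), hab.symm, fun x hx => (hm x).mp hx⟩
  · exact ⟨a, (hm a).mpr (Or.inl rfl), hab, fun x hx => ((hm x).mp hx).symm⟩

/-- A connected `2`-regular infinite graph is traversed injectively by a bi-infinite walk. -/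
theorem exists_traversal [G.LocallyFinite] (hG : IsInfiniteLine G) :
    ∃ p : ℤ → V, Function.Bijective p ∧ ∀ n x, G.Adj (p n) x ↔ x = p (n - 1) ∨ x = p (n + 1) := by
  classical
  have hreg := hG.regular
  choose! other hadj hne hall using
    (fun v u (h : G.Adj v u) => exists_unique_other hreg h)
  have hback : ∀ v u, G.Adj v u → other v (other v u) = u := fun v u h =>
    ((hall v u h _ (hadj v _ (hadj v u h))).resolve_right (hne v _ (hadj v u h)))
  -- Walking on without turning back is a permutation of the darts, so it can be iterated over all
  -- of `ℤ`.
  let e : Equiv.Perm {d : V × V // G.Adj d.1 d.2} :=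
    { toFun := fun d => ⟨(d.1.2, other d.1.2 d.1.1), hadj _ _ d.2.symm⟩
      invFun := fun d => ⟨(other d.1.1 d.1.2, d.1.1), (hadj _ _ d.2).symm⟩
      left_inv := fun d => by
        apply Subtype.ext
        simp [hback _ _ d.2.symm]
      right_inv := fun d => by
        apply Subtype.ext
        simp [hback _ _ d.2] }
  obtain ⟨v₀⟩ : Nonempty V := hG.connected.nonempty
  obtain ⟨u₀, hu₀⟩ : ∃ u, G.Adj v₀ u := by
    have hc : (G.neighborFinset v₀).card = 2 := hreg v₀
    obtain ⟨u, hu⟩ := Finset.card_pos.mp (by omega : 0 < (G.neighborFinset v₀).card)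
    exact ⟨u, (G.mem_neighborFinset v₀ u).mp hu⟩
  let d : ℤ → {d : V × V // G.Adj d.1 d.2} := fun n => (e ^ n) ⟨(v₀, u₀), hu₀⟩
  have hd : ∀ n, d (n + 1) = e (d n) := by
    intro n
    simp only [d, add_comm n 1, zpow_add, zpow_one, Equiv.Perm.mul_apply]
  let p : ℤ → V := fun n => (d n).1.1
  have hp1 : ∀ n, (d n).1.2 = p (n + 1) := fun n => by simp only [p, hd n]; rfl
  have hp2 : ∀ n, p (n + 2) = other (p (n + 1)) (p n) := by
    intro n
    have : p (n + 2) = (d (n + 1)).1.2 := by rw [hp1, add_assoc]; rfl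
    rw [this, hd n, ← hp1 n]; rfl
  have hpadj : ∀ n, G.Adj (p n) (p (n + 1)) := fun n => by rw [← hp1]; exact (d n).2
  have hnb : ∀ n x, G.Adj (p n) x ↔ x = p (n - 1) ∨ x = p (n + 1) := by
    intro n x
    have h1 : G.Adj (p n) (p (n - 1)) := by
      have := (hpadj (n - 1)).symm; rwa [sub_add_cancel] at this
    have h2 : p (n + 1) = other (p n) (p (n - 1)) := by
      have := hp2 (n - 1)
      rwa [sub_add_cancel, show n - 1 + 2 = n + 1 by ring] at this
    constructor
    · intro h
      rw [h2]; exact hall _ _ h1 x h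
    · rintro (rfl | rfl)
      · exact h1
      · exact hpadj n
  have hne2 : ∀ n, p (n + 1) ≠ p (n - 1) := by
    intro n
    have h1 : G.Adj (p n) (p (n - 1)) := (hnb n _).mpr (Or.inl rfl)
    have h2 : p (n + 1) = other (p n) (p (n - 1)) := by
      have := hp2 (n - 1)
      rwa [sub_add_cancel, show n - 1 + 2 = n + 1 by ring] at this
    rw [h2]; exact hne _ _ h1
  have hsurj : Function.Surjective p := by
    have key : ∀ a b, G.Walk a b → (∃ n, p n = a) → ∃ n, p n = b := by
      intro a b w
      induction w with
      | nil => exact id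
      | cons h _ ih =>
        rintro ⟨n, rfl⟩
        rcases (hnb n _).mp h with rfl | rfl
        · exact ih ⟨_, rfl⟩
        · exact ih ⟨_, rfl⟩
    intro x
    obtain ⟨w⟩ := hG.connected.preconnected (p 0) x
    exact key _ _ w ⟨0, rfl⟩
  refine ⟨p, ⟨?_, hsurj⟩, hnb⟩
  -- propagation of a coincidence of two consecutive vertices, with either orientation
  have hfwd : ∀ m n, p m = p n → p (m + 1) = p (n + 1) → ∀ k : ℕ,
      p (m + k) = p (n + k) ∧ p (m + k + 1) = p (n + k + 1) := by
    intro m n h0 h1 k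
    induction k with
    | zero => simpa using ⟨h0, h1⟩
    | succ k ih =>
      have e1 := hp2 (m + k)
      have e2 := hp2 (n + k)
      rw [ih.1, ih.2, ← e2] at e1
      push_cast
      refine ⟨by simpa [add_assoc] using ih.2, ?_⟩
      simpa [add_assoc, show (1 : ℤ) + 1 = 2 by norm_num] using e1
  have hrev : ∀ m n, p m = p n → p (m + 1) = p (n - 1) → ∀ k : ℕ,
      p (m + k) = p (n - k) ∧ p (m + k + 1) = p (n - k - 1) := by
    intro m n h0 h1 k
    induction k with
    | zero => simpa using ⟨h0, h1⟩
    | succ k ih =>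
      have a1 : G.Adj (p (m + k + 1)) (p (m + k + 2)) := by
        have := hpadj (m + k + 1); rwa [add_assoc (m + k : ℤ) 1 1] at this
      rw [ih.2, hnb] at a1
      have n1 : p (m + k + 2) ≠ p (m + k) := by
        have := hne2 (m + k + 1)
        rwa [add_sub_cancel_right, add_assoc (m + k : ℤ) 1 1] at this
      rw [sub_add_cancel, ← ih.1] at a1
      have a2 := a1.resolve_right n1
      push_cast
      refine ⟨?_, ?_⟩
      · rw [← add_assoc, ih.2]; congr 1; ring
      · rw [show m + ((k : ℤ) + 1) + 1 = m + k + 2 by ring, a2]; congr 1; ring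
  -- A coincidence reverses the walk or translates it. A reversed walk meets itself in the middle,
  -- which forces a turn back or a loop, by the parity of `n - m`. A translated walk is periodic, so
  -- its range is finite.
  have hmain : ∀ m n : ℤ, m < n → p m ≠ p n := by
    intro m n hmn heq
    have h1 : G.Adj (p n) (p (m + 1)) := heq ▸ hpadj m
    rcases (hnb n _).mp h1 with h | h
    · obtain ⟨h, hh⟩ := Int.even_or_odd' (n - m)
      rcases hh with hh | hh
      · obtain ⟨q, rfl⟩ : ∃ q : ℕ, h = q + 1 := ⟨(h - 1).toNat, by omega⟩
        have := (hrev m n heq ‹_› q).1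
        refine hne2 (m + q + 1) ?_
        rw [add_sub_cancel_right, this]; congr 1; omega
      · obtain ⟨q, rfl⟩ : ∃ q : ℕ, h = q := ⟨h.toNat, by omega⟩
        have := (hrev m n heq ‹_› q).1
        have h3 := hpadj (m + q)
        rw [this, show m + (q : ℤ) + 1 = n - q by omega] at h3
        exact G.irrefl h3
    · have hper : ∀ k : ℕ, p (m + k) = p (n + k) := fun k => (hfwd m n heq h k).1
      have hper' : ∀ k : ℕ, p (m - k) = p (n - k) := by
        have aux : ∀ k : ℕ, p (m - k) = p (n - k) ∧ p (m - k + 1) = p (n - k + 1) := by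
          intro k
          induction k with
          | zero => simpa using ⟨heq, h⟩
          | succ k ih =>
            have a1 : G.Adj (p (n - k)) (p (m - k - 1)) := by
              rw [← ih.1]; exact (hnb _ _).mpr (Or.inl rfl)
            have n1 : p (m - k - 1) ≠ p (n - k + 1) := by
              rw [← ih.2]; exact (hne2 _).symm
            have a2 := ((hnb _ _).mp a1).resolve_right n1
            push_cast
            refine ⟨by rw [← sub_sub, a2, ← sub_sub], ?_⟩
            rw [← sub_sub, ← sub_sub, sub_add_cancel, sub_add_cancel]; exact ih.1
        exact fun k => (aux k).1
      have hall : ∀ j, p j = p (j + (n - m)) := by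
        intro j
        rcases le_total m j with hj | hj
        · obtain ⟨k, rfl⟩ : ∃ k : ℕ, j = m + k := ⟨(j - m).toNat, by omega⟩
          rw [hper k]; congr 1; ring
        · obtain ⟨k, rfl⟩ : ∃ k : ℕ, j = m - k := ⟨(m - j).toNat, by omega⟩
          rw [hper' k]; congr 1; ring
      have hperiodic : Function.Periodic p (n - m) := fun j => (hall j).symm
      have hfin : (Set.range p).Finite := by
        refine Set.Finite.subset ((Set.finite_Ico (0 : ℤ) (n - m)).image p) ?_
        rintro _ ⟨j, rfl⟩
        obtain ⟨y, hy, he⟩ := hperiodic.exists_mem_Ico₀ (by omega) j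
        exact ⟨y, hy, he.symm⟩
      rw [hsurj.range_eq] at hfin
      have := hG.infinite
      exact Set.infinite_univ hfin
  intro m n h
  by_contra hne'
  rcases lt_or_gt_of_ne hne' with h' | h'
  · exact hmain m n h' h
  · exact hmain n m h' h.symm

/-- The index along the traversal is the coordinate: the traversal is a walk of the right length,
and no edge changes the index by more than one. -/
theorem IsInfiniteLine.lineMetric [G.LocallyFinite] (hG : IsInfiniteLine G) : LineMetric G := by
  obtain ⟨p, hp, hadj⟩ := exists_traversal hG
  have hadj' : ∀ n, G.Adj (p n) (p (n + 1)) := fun n => (hadj n _).mpr (Or.inr rfl)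
  let e := Equiv.ofBijective p hp
  have hup : ∀ m (k : ℕ), G.edist (p m) (p (m + k)) ≤ k := by
    intro m k
    induction k with
    | zero => simp
    | succ k ih =>
      refine edist_le_succ_iff'.mpr (Or.inr ⟨_, ih, ?_⟩)
      have := hadj' (m + k)
      push_cast; rwa [add_assoc] at this
  have hlow : ∀ a b, ∀ w : G.Walk a b, (e.symm a - e.symm b).natAbs ≤ w.length := by
    intro a b w
    induction w with
    | nil => simp
    | @cons a c b h q ih =>
      obtain ⟨n, rfl⟩ := hp.2 a
      have hn : ∀ j, e.symm (p j) = j := fun j => e.symm_apply_apply j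
      simp only [SimpleGraph.Walk.length_cons]
      rcases (hadj n _).mp h with rfl | rfl
      · rw [hn] at ih ⊢; omega
      · rw [hn] at ih ⊢; omega
  intro v
  refine ⟨e.symm, fun x y _ _ => le_antisymm ?_ ?_⟩
  · obtain ⟨m, rfl⟩ := hp.2 x
    obtain ⟨n, rfl⟩ := hp.2 y
    have hn : ∀ j, e.symm (p j) = j := fun j => e.symm_apply_apply j
    rw [hn, hn]
    rcases le_total m n with h | h
    · have := hup m (m - n).natAbs
      rwa [show m + ((m - n).natAbs : ℤ) = n by omega] at this
    · have := hup n (m - n).natAbs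
      rwa [show n + ((m - n).natAbs : ℤ) = m by omega, SimpleGraph.edist_comm] at this
  · obtain ⟨w, hw⟩ := (hG.connected.preconnected x y).exists_walk_length_eq_edist
    rw [← hw]; exact_mod_cast hlow x y w

/-- In a line, a set whose points have pairwise distance at least `α` has at most `2 q` points
other than `v` within distance less than `(q + 1) α` of its point `v`. -/
theorem LineMetric.ncard_packing_le (hG : LineMetric G) {A : Set V} {α k q : ℕ} (hα : 1 ≤ α)
    (hA : ∀ u ∈ A, ∀ w ∈ A, u ≠ w → (α : ℕ∞) ≤ G.edist u w) (hk : k < (q + 1) * α) {v : V}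
    (hv : v ∈ A) :
    {y ∈ A | y ≠ v ∧ G.edist v y ≤ k}.Finite ∧ {y ∈ A | y ≠ v ∧ G.edist v y ≤ k}.ncard ≤ 2 * q := by
  classical
  obtain ⟨pos, hpos⟩ := hG v
  set N := {y ∈ A | y ≠ v ∧ G.edist v y ≤ k}
  have hfin : ∀ y ∈ N, G.edist v y ≠ ⊤ := fun y hy =>
    ne_top_of_le_ne_top (ENat.natCast_ne_top k) hy.2.2
  have hvv : G.edist v v ≠ ⊤ := by simp
  have hd : ∀ y ∈ N, (pos v - pos y).natAbs ≤ k ∧ α ≤ (pos v - pos y).natAbs := by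
    intro y hy
    have h1 := hpos v y hvv (hfin y hy)
    have h2 := hy.2.2
    have h3 := hA v hv y hy.1 hy.2.1.symm
    rw [h1] at h2 h3
    exact ⟨by exact_mod_cast h2, by exact_mod_cast h3⟩
  -- The side of `v` and the distance to `v` in units of `α`. Points with equal values would be less
  -- than `α` apart; quotient 0 is excluded by the packing and quotients above `q` by `hk`.
  let f : V → Bool × ℕ := fun y => (decide (pos y < pos v), (pos v - pos y).natAbs / α)
  let T : Finset (Bool × ℕ) := Finset.univ ×ˢ Finset.Icc 1 q
  have hmaps : ∀ y ∈ N, f y ∈ (T : Set (Bool × ℕ)) := by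
    intro y hy
    obtain ⟨h1, h2⟩ := hd y hy
    simp only [T, Finset.coe_product, Set.mem_prod, f, Finset.coe_univ, Set.mem_univ, true_and,
      Finset.coe_Icc, Set.mem_Icc]
    refine ⟨(Nat.one_le_div_iff (by omega)).mpr h2, ?_⟩
    exact Nat.lt_succ_iff.mp ((Nat.div_lt_iff_lt_mul (by omega)).mpr (lt_of_le_of_lt h1 hk))
  have hinj : Set.InjOn f N := by
    intro y hy z hz hyz
    by_contra hne
    have h1 := hA y hy.1 z hz.1 hne
    rw [hpos y z (hfin y hy) (hfin z hz)] at h1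
    have h1' : α ≤ (pos y - pos z).natAbs := by exact_mod_cast h1
    simp only [f, Prod.mk.injEq, decide_eq_decide] at hyz
    obtain ⟨hs, hq⟩ := hyz
    have e1 := Nat.div_add_mod (pos v - pos y).natAbs α
    have e2 := Nat.div_add_mod (pos v - pos z).natAbs α
    have l1 := Nat.mod_lt (pos v - pos y).natAbs (by omega : α > 0)
    have l2 := Nat.mod_lt (pos v - pos z).natAbs (by omega : α > 0)
    rw [hq] at e1
    omega
  have hTfin : (T : Set (Bool × ℕ)).Finite := T.finite_toSet
  refine ⟨Set.Finite.of_injOn hmaps hinj hTfin, ?_⟩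
  calc N.ncard ≤ (T : Set (Bool × ℕ)).ncard := Set.ncard_le_ncard_of_injOn f hmaps hinj hTfin
    _ = 2 * q := by rw [Set.ncard_coe_finset]; simp [T]

end LineMetric

/-! ### Iterated logarithm and towers. -/

section IteratedLog

theorem one_le_logStar (x : ℝ) : 1 ≤ logStar x := by
  rw [logStar]; split_ifs <;> omega

/-- The tower function `1, 2, 4, 16, …`. -/
def tower : ℕ → ℕ
  | 0 => 1
  | n + 1 => 2 ^ tower n

theorem one_le_tower (n : ℕ) : 1 ≤ tower n := by
  cases n with
  | zero => exact le_rfl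
  | succ n => exact Nat.one_le_two_pow

/-- Each unfolding of `logStar` undoes one exponentiation. This makes the label classes finite and
bounds the number of bits of their labels. -/
theorem le_tower_of_logStar_le : ∀ (i : ℕ) (x : ℝ), logStar x ≤ i + 1 → x ≤ tower i := by
  intro i
  induction i with
  | zero =>
    intro x h
    rw [logStar] at h
    split_ifs at h with hx
    · simpa [tower] using hx
    · have := one_le_logStar (Real.logb 2 x); omega
  | succ i ih =>
    intro x h
    rw [logStar] at h
    split_ifs at h with hx
    · exact hx.trans (by exact_mod_cast one_le_tower _)
    · have h1 := ih (Real.logb 2 x) (by omega)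
      rw [Real.logb_le_iff_le_rpow (by norm_num) (by linarith), Real.rpow_natCast] at h1
      simpa [tower] using h1

theorem finite_labelClass {V : Type*} {ℓ : V → ℕ} (hℓ : Function.Injective ℓ) (i : ℕ) :
    (labelClass ℓ i).Finite := by
  refine Set.Finite.of_finite_image (f := ℓ) ((Set.finite_Iic (tower i)).subset ?_) hℓ.injOn
  rintro _ ⟨v, hv, rfl⟩
  have hv' : logStar (ℓ v : ℝ) = i := hv
  exact_mod_cast le_tower_of_logStar_le i (ℓ v) (by omega)

end IteratedLog

/-! ### Greedy steps: packing and covering. -/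

section Greedy

variable {V : Type*} {G : SimpleGraph V} {ℓ : V → ℕ} {U S : Set V} {R : ℕ}

theorem le_distToSet_iff {v : V} {n : ℕ∞} :
    n ≤ distToSet G S v ↔ ∀ s ∈ S, n ≤ G.edist v s := by
  simp [distToSet]

theorem distToSet_le_iff {v : V} {n : ℕ} :
    distToSet G S v ≤ n ↔ ∃ s ∈ S, G.edist v s ≤ n := by
  constructor
  · intro h
    by_contra! hc
    have : ((n : ℕ∞) + 1) ≤ distToSet G S v :=
      le_distToSet_iff.mpr fun s hs => Order.add_one_le_of_lt (hc s hs)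
    have h2 := this.trans h
    have h3 : n + 1 ≤ n := by exact_mod_cast h2
    omega
  · rintro ⟨s, hs, h⟩
    exact (iInf₂_le s hs).trans h

theorem mem_candidates_iff {v : V} :
    v ∈ candidates G U R S ↔ v ∈ U ∧ ∀ s ∈ S, (R : ℕ∞) ≤ G.edist v s := by
  simp only [candidates, Set.mem_ofPred_eq, le_distToSet_iff]

theorem subset_greedyStep : S ⊆ greedyStep G ℓ U R S := Set.subset_union_left

theorem greedyStep_subset : greedyStep G ℓ U R S ⊆ S ∪ U := by
  rintro v (hv | hv)
  · exact Or.inl hv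
  · exact Or.inr hv.1.1

theorem subset_greedyStep_iterate (n : ℕ) : S ⊆ (greedyStep G ℓ U R)^[n] S := by
  induction n with
  | zero => exact subset_rfl
  | succ n ih => rw [Function.iterate_succ_apply']; exact ih.trans subset_greedyStep

theorem greedyStep_iterate_subset (n : ℕ) : (greedyStep G ℓ U R)^[n] S ⊆ S ∪ U := by
  induction n with
  | zero => exact Set.subset_union_left
  | succ n ih =>
    rw [Function.iterate_succ_apply']
    exact greedyStep_subset.trans (Set.union_subset ih Set.subset_union_right)

theorem greedyStep_iterate_mono {m n : ℕ} (h : m ≤ n) :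
    (greedyStep G ℓ U R)^[m] S ⊆ (greedyStep G ℓ U R)^[n] S := by
  obtain ⟨k, rfl⟩ := Nat.exists_eq_add_of_le' h
  rw [Function.iterate_add_apply]
  exact subset_greedyStep_iterate k

/-- Two new members at distance less than `R` would each have to precede the other in a strict
order. -/
theorem greedyStep_packing (hR : 1 ≤ R)
    (hS : ∀ u ∈ S, ∀ v ∈ S, u ≠ v → (R : ℕ∞) ≤ G.edist u v) :
    ∀ u ∈ greedyStep G ℓ U R S, ∀ v ∈ greedyStep G ℓ U R S, u ≠ v →
      (R : ℕ∞) ≤ G.edist u v := by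
  rintro u (hu | hu) v (hv | hv) huv
  · exact hS u hu v hv huv
  · rw [SimpleGraph.edist_comm]; exact (mem_candidates_iff.mp hv.1).2 u hu
  · exact (mem_candidates_iff.mp hu.1).2 v hv
  · by_contra hlt
    rw [not_le, edist_lt_iff_le_pred hR] at hlt
    have h1 := hu.2 v hv.1 huv.symm hlt
    have h2 := hv.2 u hu.1 huv (by rwa [SimpleGraph.edist_comm])
    rcases h1 with h1 | ⟨h1, h1'⟩ <;> rcases h2 with h2 | ⟨h2, h2'⟩
    · exact lt_asymm h1 h2
    · exact h1.ne h2.symm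
    · exact h2.ne h1.symm
    · exact lt_asymm h1' h2'

theorem greedyStep_iterate_packing (hR : 1 ≤ R)
    (hS : ∀ u ∈ S, ∀ v ∈ S, u ≠ v → (R : ℕ∞) ≤ G.edist u v) (n : ℕ) :
    ∀ u ∈ (greedyStep G ℓ U R)^[n] S, ∀ v ∈ (greedyStep G ℓ U R)^[n] S, u ≠ v →
      (R : ℕ∞) ≤ G.edist u v := by
  induction n with
  | zero => exact hS
  | succ n ih => rw [Function.iterate_succ_apply']; exact greedyStep_packing hR ih

/-- `x` lies in the same gap of `S₀` as `v`, with respect to the coordinate `pos`. -/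
def SameGap (G : SimpleGraph V) (pos : V → ℤ) (S₀ : Set V) (v x : V) : Prop :=
  G.edist v x ≠ ⊤ ∧ ∀ s ∈ S₀, G.edist v s ≠ ⊤ →
    (pos s < pos v ∧ pos s < pos x) ∨ (pos v < pos s ∧ pos x < pos s)

theorem edist_ne_top_trans {a b c : V} (h : G.edist a b ≠ ⊤) (h' : G.edist b c ≠ ⊤) :
    G.edist a c ≠ ⊤ := by
  rw [SimpleGraph.edist_ne_top_iff_reachable] at *
  exact h.trans h'

/-- As long as a gap contains a candidate, a greedy step adds a candidate of that gap. -/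
theorem exists_mem_greedyStep_of_sameGap (hR : 1 ≤ R) (hℓ : Function.Injective ℓ) (hU : U.Finite)
    {S₀ : Set V} {v : V} {pos : V → ℤ}
    (hpos : ∀ x y, G.edist v x ≠ ⊤ → G.edist v y ≠ ⊤ →
      G.edist x y = ((pos x - pos y).natAbs : ℕ))
    (hS₀ : S₀ ⊆ S) (hv : v ∈ candidates G U R S) :
    ∃ x ∈ greedyStep G ℓ U R S, x ∈ candidates G U R S ∧ SameGap G pos S₀ v x := by
  have hvv : G.edist v v ≠ ⊤ := by simp
  have hvgap : SameGap G pos S₀ v v := by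
    refine ⟨hvv, fun s hs hvs => ?_⟩
    have h1 := (mem_candidates_iff.mp hv).2 s (hS₀ hs)
    rw [hpos v s hvv hvs] at h1
    have h2 : R ≤ (pos v - pos s).natAbs := by exact_mod_cast h1
    omega
  set C : Set V := {x ∈ candidates G U R S | SameGap G pos S₀ v x}
  have hCfin : C.Finite := hU.subset fun x hx => hx.1.1
  obtain ⟨x, hx, hmax⟩ := Set.exists_max_image C
    (fun x => toLex (distToSet G S x, ℓ x)) hCfin ⟨v, hv, hvgap⟩
  refine ⟨x, Or.inr ⟨hx.1, fun u hu hux hd => ?_⟩, hx.1, hx.2⟩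
  have hxu : G.edist x u ≠ ⊤ := ne_top_of_le_ne_top (ENat.natCast_ne_top _) hd
  have hvu : G.edist v u ≠ ⊤ := edist_ne_top_trans hx.2.1 hxu
  -- Both `x` and `u` are at distance at least `R` from `s` but less than `R` from each other, so
  -- `s` cannot separate them. Hence being maximal within the gap is enough.
  have hugap : SameGap G pos S₀ v u := by
    refine ⟨hvu, fun s hs hvs => ?_⟩
    have h1 := (mem_candidates_iff.mp hx.1).2 s (hS₀ hs)
    have h2 := (mem_candidates_iff.mp hu).2 s (hS₀ hs)
    rw [hpos _ s hx.2.1 hvs] at h1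
    rw [hpos _ s hvu hvs] at h2
    rw [hpos _ _ hx.2.1 hvu] at hd
    have h1' : R ≤ (pos x - pos s).natAbs := by exact_mod_cast h1
    have h2' : R ≤ (pos u - pos s).natAbs := by exact_mod_cast h2
    have hd' : (pos x - pos u).natAbs ≤ R - 1 := by exact_mod_cast hd
    have h3 := hx.2.2 s hs hvs
    omega
  have hle := hmax u ⟨hu, hugap⟩
  rw [Prod.Lex.toLex_le_toLex] at hle
  rcases hle with h | ⟨h, h'⟩
  · exact Or.inl h
  · exact Or.inr ⟨h, lt_of_le_of_ne h' fun e => hux (hℓ e)⟩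

/-- If all of `U` is within distance less than `3 R` of `S₀`, then four greedy steps suffice to
cover `U`. -/
theorem greedyStep_iterate_covering (hG : LineMetric G) (hR : 1 ≤ R) (hℓ : Function.Injective ℓ)
    (hU : U.Finite) {S₀ : Set V} (hcov : ∀ v ∈ U, ∃ s ∈ S₀, G.edist v s < (3 * R : ℕ))
    {n : ℕ} (hn : 4 ≤ n) :
    ∀ v ∈ U, ∃ s ∈ (greedyStep G ℓ U R)^[n] S₀, G.edist v s ≤ ((R - 1 : ℕ) : ℕ∞) := by
  intro v hv
  by_contra! hc
  obtain ⟨pos, hpos⟩ := hG v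
  have hvcand : ∀ k ≤ 4, v ∈ candidates G U R ((greedyStep G ℓ U R)^[k] S₀) := by
    intro k hk
    refine mem_candidates_iff.mpr ⟨hv, fun s hs => ?_⟩
    have h1 := hc s (greedyStep_iterate_mono (hk.trans hn) hs)
    by_contra h2
    rw [not_le, edist_lt_iff_le_pred hR] at h2
    exact absurd h2 (not_le.mpr h1)
  -- Four steps yield five points: `v` is still a candidate after the fourth step, so `x 4` exists
  -- and keeps distance `R` from the first four, even if it is not in the final set.
  have hex : ∀ k : ℕ, ∃ x, k ≤ 4 → x ∈ candidates G U R ((greedyStep G ℓ U R)^[k] S₀) ∧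
      SameGap G pos S₀ v x ∧ x ∈ (greedyStep G ℓ U R)^[k + 1] S₀ := by
    intro k
    by_cases hk : k ≤ 4
    · obtain ⟨x, h1, h2, h3⟩ := exists_mem_greedyStep_of_sameGap hR hℓ hU hpos
        (subset_greedyStep_iterate k) (hvcand k hk)
      exact ⟨x, fun _ => ⟨h2, h3, by rwa [Function.iterate_succ_apply']⟩⟩
    · exact ⟨v, fun h => absurd h hk⟩
  choose x hx using hex
  have hvv : G.edist v v ≠ ⊤ := by simp
  have hsep : ∀ j k, j < k → k ≤ 4 → R ≤ (pos (x k) - pos (x j)).natAbs := by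
    intro j k hjk hk
    have h1 := (mem_candidates_iff.mp (hx k hk).1).2 (x j)
      (greedyStep_iterate_mono (Nat.succ_le_of_lt hjk) (hx j (by omega)).2.2)
    rw [hpos _ _ (hx k hk).2.1.1 (hx j (by omega)).2.1.1] at h1
    exact_mod_cast h1
  have hsep' : ∀ j k : Fin 5, j ≠ k → R ≤ (pos (x k) - pos (x j)).natAbs := by
    intro j k hjk
    rcases lt_or_gt_of_ne hjk with h | h
    · exact hsep j k h (by omega)
    · have := hsep k j h (by omega); omega
  have hnear : ∀ k : Fin 5, ∃ z : ℤ,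
      (∀ j : Fin 5, R ≤ (pos (x j) - z).natAbs ∧ ((z < pos v ∧ z < pos (x j)) ∨
        (pos v < z ∧ pos (x j) < z))) ∧ (pos (x k) - z).natAbs < 3 * R := by
    intro k
    have hk : (k : ℕ) ≤ 4 := by omega
    obtain ⟨s, hs, hd⟩ := hcov (x k) (hx k hk).1.1
    have hvs : G.edist v s ≠ ⊤ := edist_ne_top_trans (hx k hk).2.1.1 (ne_top_of_lt hd)
    refine ⟨pos s, fun j => ?_, ?_⟩
    · have hj : (j : ℕ) ≤ 4 := by omega
      refine ⟨?_, (hx j hj).2.1.2 s hs hvs⟩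
      have h1 := (mem_candidates_iff.mp (hx j hj).1).2 s (subset_greedyStep_iterate _ hs)
      rw [hpos _ _ (hx j hj).2.1.1 hvs] at h1
      exact_mod_cast h1
    · rw [hpos _ _ (hx k hk).2.1.1 hvs] at hd
      exact_mod_cast hd
  choose z hz hz' using hnear
  -- Three of the five points have their close point `z` on the same side of `v`. They are `R` away
  -- from the nearest of these three `z` and from one another, so the farthest of them is at least
  -- `3 * R` from its own `z`.
  obtain ⟨b, hb⟩ := Fintype.exists_lt_card_fiber_of_mul_lt_card
    (fun k : Fin 5 => decide (z k < pos v)) (n := 2) (by simp)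
  obtain ⟨j, hj, k, hk, l, hl, hjk, hjl, hkl⟩ := Finset.two_lt_card.mp hb
  simp only [Finset.mem_filter, Finset.mem_univ, true_and] at hj hk hl
  have s1 := hsep' j k hjk
  have s2 := hsep' j l hjl
  have s3 := hsep' k l hkl
  have nj := hz' j
  have nk := hz' k
  have nl := hz' l
  have jj := hz j j
  have jk := hz j k
  have jl := hz j l
  have kj := hz k j
  have kk := hz k k
  have kl := hz k l
  have lj := hz l j
  have lk := hz l k
  have ll := hz l l
  cases b
  · simp only [decide_eq_false_iff_not] at hj hk hl
    omega
  · simp only [decide_eq_true_eq] at hj hk hl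
    omega

end Greedy

/-! ### Correctness of PathRulingSet. -/

section PathRulingSet

variable {V : Type*} {G : SimpleGraph V} {ℓ : V → ℕ} {U : Set V} {R : ℕ}

/-- The sum of the radii of the first `n` iterations. -/
def misRadiusSum (R n : ℕ) : ℕ := ∑ j ∈ Finset.range n, misRadius R (j + 1)

/-- With `d = Nat.clog 2 R ≥ 1`, the radii `2 ^ j - 1` for `j < d` sum to at most `2 ^ d - 2`, which
is less than `2 * R` since `2 ^ (d - 1) < R`; the last radius adds `R - 1`. -/
theorem misRadiusSum_lt (hR : 1 ≤ R) : misRadiusSum R (Nat.clog 2 R) < 3 * R := by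
  have h : ∀ n, n + 1 ≤ Nat.clog 2 R → misRadiusSum R n + 2 ≤ 2 ^ (n + 1) := by
    intro n
    induction n with
    | zero => intro _; simp [misRadiusSum]
    | succ n ih =>
      intro hn
      have h1 := ih (by omega)
      have h2 : misRadius R (n + 1) = 2 ^ (n + 1) - 1 := if_pos hn
      have h3 : misRadiusSum R (n + 1) = misRadiusSum R n + misRadius R (n + 1) :=
        Finset.sum_range_succ _ _
      have h4 : 2 ^ (n + 1 + 1) = 2 * 2 ^ (n + 1) := by ring
      have h5 : 1 ≤ 2 ^ (n + 1) := Nat.one_le_two_pow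
      omega
  rcases Nat.eq_zero_or_pos (Nat.clog 2 R) with h0 | h0
  · rw [h0]; simp [misRadiusSum]; omega
  · obtain ⟨n, hn⟩ : ∃ n, Nat.clog 2 R = n + 1 := ⟨Nat.clog 2 R - 1, by omega⟩
    have h1 := h n (by omega)
    have h2 : misRadius R (n + 1) = R - 1 := if_neg (by omega)
    have h3 : misRadiusSum R (n + 1) = misRadiusSum R n + misRadius R (n + 1) :=
      Finset.sum_range_succ _ _
    have h4 : 2 ^ (n + 1) = 2 * 2 ^ n := by ring
    have h5 : 2 ^ n < R := by
      rw [← Nat.lt_clog_iff_pow_lt (by norm_num)]; omega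
    rw [hn]
    omega

theorem IsMISOn.lt_edist {k : ℕ} {S : Set V} (h : IsMISOn (powerGraph G k) U S) :
    ∀ u ∈ S, ∀ v ∈ S, u ≠ v → ((k + 1 : ℕ) : ℕ∞) ≤ G.edist u v := by
  intro u hu v hv huv
  by_contra hlt
  rw [not_le, edist_lt_iff_le_pred (by omega)] at hlt
  exact h.independent u hu v hv ⟨huv, hlt⟩

theorem IsMISOn.exists_edist_le {k : ℕ} {S : Set V} (h : IsMISOn (powerGraph G k) U S) :
    ∀ u ∈ U, ∃ v ∈ S, G.edist u v ≤ k := by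
  intro u hu
  by_cases hS : u ∈ S
  · exact ⟨u, hS, by simp⟩
  · obtain ⟨v, hv, h'⟩ := h.dominating u hu hS
    exact ⟨v, hv, h'.2⟩

theorem misChain_covering {M : ℕ → Set V} (h0 : M 0 = U) {n : ℕ}
    (hM : ∀ i, 1 ≤ i → i ≤ n → IsMISOn (powerGraph G (misRadius R i)) (M (i - 1)) (M i)) :
    ∀ u ∈ U, ∃ v ∈ M n, G.edist u v ≤ misRadiusSum R n := by
  induction n with
  | zero => intro u hu; exact ⟨u, h0 ▸ hu, by simp⟩
  | succ n ih =>
    intro u hu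
    obtain ⟨v, hv, hd⟩ := ih (fun i h1 h2 => hM i h1 (by omega)) u hu
    obtain ⟨w, hw, hd'⟩ := (hM (n + 1) (by omega) le_rfl).exists_edist_le v hv
    refine ⟨w, hw, ?_⟩
    have := edist_le_add hd hd'
    rwa [show misRadiusSum R (n + 1) = misRadiusSum R n + misRadius R (n + 1) from
      Finset.sum_range_succ _ _]

theorem misChain_subset {M : ℕ → Set V} (h0 : M 0 = U) {n : ℕ}
    (hM : ∀ i, 1 ≤ i → i ≤ n → IsMISOn (powerGraph G (misRadius R i)) (M (i - 1)) (M i)) :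
    M n ⊆ U := by
  induction n with
  | zero => exact h0.subset
  | succ n ih =>
    exact (hM (n + 1) (by omega) le_rfl).subset.trans (ih fun i h1 h2 => hM i h1 (by omega))

theorem misChain_packing (hR : 1 ≤ R) {M : ℕ → Set V}
    (hM : ∀ i, 1 ≤ i → i ≤ Nat.clog 2 R →
      IsMISOn (powerGraph G (misRadius R i)) (M (i - 1)) (M i)) :
    ∀ u ∈ M (Nat.clog 2 R), ∀ v ∈ M (Nat.clog 2 R), u ≠ v → (R : ℕ∞) ≤ G.edist u v := by
  intro u hu v hv huv
  rcases Nat.eq_zero_or_pos (Nat.clog 2 R) with hd | hd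
  -- Without any iteration `R = 1`, and distinctness is all that is needed.
  · have hR1 : R = 1 := by
      have := Nat.le_pow_clog (b := 2) (by norm_num) R
      rw [hd] at this; omega
    rw [hR1, Nat.cast_one, Order.one_le_iff_pos]
    exact pos_iff_ne_zero.mpr fun h => huv (SimpleGraph.edist_eq_zero_iff.mp h)
  · have h := (hM _ hd le_rfl).lt_edist u hu v hv huv
    rwa [show misRadius R (Nat.clog 2 R) = R - 1 from if_neg (by omega),
      Nat.sub_add_cancel hR] at h

/-- Every result of `PathRulingSet` on a finite set is a ruling set. -/
theorem IsPathRulingSetResult.isLimitedRulingSet (hG : LineMetric G) (hR : 1 ≤ R)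
    (hℓ : Function.Injective ℓ) (hU : U.Finite) {P : Set V}
    (h : IsPathRulingSetResult G ℓ U R P) : IsLimitedRulingSet G U P R (R - 1) := by
  obtain ⟨M, h0, hM, rfl⟩ := h
  refine ⟨?_, ?_, ?_⟩
  · exact (greedyStep_iterate_subset 6).trans
      (Set.union_subset (misChain_subset h0 hM) subset_rfl)
  · exact greedyStep_iterate_packing hR (misChain_packing hR hM) 6
  · refine greedyStep_iterate_covering hG hR hℓ hU (fun v hv => ?_) (by norm_num)
    obtain ⟨s, hs, hd⟩ := misChain_covering h0 hM v hv
    exact ⟨s, hs, lt_of_le_of_lt hd (by exact_mod_cast misRadiusSum_lt hR)⟩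

end PathRulingSet

/-! ### Correctness of every run of ES-ColPathRulingSet. -/

section Trace

variable {V : Type*} {G : SimpleGraph V} {ℓ : V → ℕ} {R : ℕ} {S : ℕ → Set V} {χ : V → Fin 17}

/-- Adding to a packing `S₁` the points of a ruling set `P` of `U` that are not near `S₁` leaves
`U` within distance `3 R`. -/
theorem merge_covering (hR : 1 ≤ R) {U P S₁ : Set V} (hP : IsLimitedRulingSet G U P R (R - 1)) :
    ∀ v ∈ U, ∃ s ∈ S₁ ∪ (P \ neighborhood G (R - 1) S₁), G.edist v s < (3 * R : ℕ) := by
  intro v hv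
  obtain ⟨p, hp, hd⟩ := hP.covering v hv
  by_cases hn : p ∈ neighborhood G (R - 1) S₁
  · obtain ⟨s, hs, hd'⟩ := hn
    refine ⟨s, Or.inl hs, lt_of_le_of_lt (edist_le_add hd hd') ?_⟩
    exact_mod_cast (by omega : R - 1 + (R - 1) < 3 * R)
  · refine ⟨p, Or.inr ⟨hp, hn⟩, lt_of_le_of_lt hd ?_⟩
    exact_mod_cast (by omega : R - 1 < 3 * R)

theorem merge_packing (hR : 1 ≤ R) {U P S₁ : Set V} (hP : IsLimitedRulingSet G U P R (R - 1))
    (hS : ∀ u ∈ S₁, ∀ v ∈ S₁, u ≠ v → (R : ℕ∞) ≤ G.edist u v) :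
    ∀ u ∈ S₁ ∪ (P \ neighborhood G (R - 1) S₁), ∀ v ∈ S₁ ∪ (P \ neighborhood G (R - 1) S₁),
      u ≠ v → (R : ℕ∞) ≤ G.edist u v := by
  have key : ∀ u ∈ S₁, ∀ v ∈ P \ neighborhood G (R - 1) S₁, (R : ℕ∞) ≤ G.edist v u := by
    intro u hu v hv
    by_contra hlt
    rw [not_le, edist_lt_iff_le_pred hR] at hlt
    exact hv.2 ⟨u, hu, hlt⟩
  rintro u (hu | hu) v (hv | hv) huv
  · exact hS u hu v hv huv
  · rw [SimpleGraph.edist_comm]; exact key u hu v hv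
  · exact key v hv u hu
  · exact hP.packing u hu.1 v hv.1 huv

/-- The part of `IsESColTrace` that concerns the sets. -/
structure IsSetTrace (G : SimpleGraph V) (ℓ : V → ℕ) (R : ℕ) (S : ℕ → Set V) : Prop where
  start : S 0 = ∅
  extend : ∀ i, 1 ≤ i → ∃ P : Set V,
    IsPathRulingSetResult G ℓ (labelClass ℓ i) R P ∧
    S i = (greedyStep G ℓ (labelClass ℓ i) R)^[4]
      (S (i - 1) ∪ (P \ neighborhood G (R - 1) (S (i - 1))))

theorem IsESColTrace.isSetTrace (h : IsESColTrace G ℓ R S χ) : IsSetTrace G ℓ R S :=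
  ⟨h.start, h.extend⟩

namespace IsSetTrace

theorem subset_succ (h : IsSetTrace G ℓ R S) (i : ℕ) : S i ⊆ S (i + 1) := by
  obtain ⟨P, -, hS⟩ := h.extend (i + 1) (by omega)
  rw [hS]
  exact Set.subset_union_left.trans (subset_greedyStep_iterate 4)

theorem mono (h : IsSetTrace G ℓ R S) : Monotone S := monotone_nat_of_le_succ h.subset_succ

theorem isLimitedRulingSet (hG : LineMetric G) (hR : 1 ≤ R) (hℓ : Function.Injective ℓ)
    (h : IsSetTrace G ℓ R S) (i : ℕ) :
    IsLimitedRulingSet G {v | logStar (ℓ v) ≤ i} (S i) R (R - 1) := by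
  induction i with
  | zero =>
    rw [h.start]
    refine ⟨by simp, by simp, fun u hu => ?_⟩
    have hu' : logStar (ℓ u : ℝ) ≤ 0 := hu
    have := one_le_logStar (ℓ u : ℝ)
    omega
  | succ i ih =>
    obtain ⟨P, hP, hS⟩ := h.extend (i + 1) (by omega)
    rw [Nat.add_sub_cancel] at hS
    have hfin := finite_labelClass hℓ (i + 1)
    have hP' := hP.isLimitedRulingSet hG hR hℓ hfin
    refine ⟨?_, ?_, ?_⟩
    · rw [hS]
      refine (greedyStep_iterate_subset 4).trans ?_
      rintro v ((hv | hv) | hv)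
      · exact Nat.le_succ_of_le (ih.subset hv)
      · exact le_of_eq (hP'.subset hv.1)
      · exact le_of_eq hv
    · rw [hS]
      exact greedyStep_iterate_packing hR (merge_packing hR hP' ih.packing) 4
    · intro u hu
      have hu' : logStar (ℓ u : ℝ) ≤ i + 1 := hu
      rcases Nat.lt_or_ge i (logStar (ℓ u : ℝ)) with hi | hi
      · rw [hS]
        exact greedyStep_iterate_covering hG hR hℓ hfin (merge_covering hR hP') le_rfl u
          (show logStar (ℓ u : ℝ) = i + 1 by omega)
      · obtain ⟨s, hs, hd⟩ := ih.covering u hi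
        exact ⟨s, h.subset_succ i hs, hd⟩

theorem logStar_eq_of_mem_diff (hG : LineMetric G) (hR : 1 ≤ R) (hℓ : Function.Injective ℓ)
    (h : IsSetTrace G ℓ R S) {i : ℕ} {v : V} (hv : v ∈ S (i + 1)) (hv' : v ∉ S i) :
    logStar (ℓ v) = i + 1 := by
  obtain ⟨P, hP, hS⟩ := h.extend (i + 1) (by omega)
  rw [Nat.add_sub_cancel] at hS
  have hP' := hP.isLimitedRulingSet hG hR hℓ (finite_labelClass hℓ (i + 1))
  rw [hS] at hv
  rcases greedyStep_iterate_subset 4 hv with (hv | hv) | hv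
  · exact absurd hv hv'
  · exact hP'.subset hv.1
  · exact hv

/-- Since only vertices of the current class join, membership is settled when the class of `v` is
treated; a committed output is never contradicted by later sets. -/
theorem mem_of_mem (hG : LineMetric G) (hR : 1 ≤ R) (hℓ : Function.Injective ℓ)
    (h : IsSetTrace G ℓ R S) {i : ℕ} {v : V} (hv : v ∈ S i) : v ∈ S (logStar (ℓ v)) := by
  induction i with
  | zero => rw [h.start] at hv; exact hv.elim
  | succ i ih =>
    by_cases hv' : v ∈ S i
    · exact ih hv'
    · rw [h.logStar_eq_of_mem_diff hG hR hℓ hv hv']; exact hv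

end IsSetTrace

theorem IsESColTrace.proper (h : IsESColTrace G ℓ R S χ) (i : ℕ) :
    ∀ u ∈ S i, ∀ v ∈ S i, (powerGraph G (9 * R - 1)).Adj u v → χ u ≠ χ v := by
  induction i with
  | zero => intro u hu; rw [h.start] at hu; exact hu.elim
  | succ i ih =>
    have hc := h.color (i + 1) (by omega)
    rw [Nat.add_sub_cancel] at hc
    have key : ∀ u ∈ S (i + 1), u ∉ S i → ∀ v ∈ S i,
        (powerGraph G (9 * R - 1)).Adj u v → χ u ≠ χ v := by
      intro u hu hu' v hv hadj
      exact hc.mem_list u ⟨hu, hu'⟩ v ⟨hv, u, rfl, by rw [SimpleGraph.edist_comm]; exact hadj.2⟩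
    intro u hu v hv hadj
    by_cases hu' : u ∈ S i <;> by_cases hv' : v ∈ S i
    · exact ih u hu' v hv' hadj
    · exact (key v hv hv' u hu' hadj.symm).symm
    · exact key u hu hu' v hv' hadj
    · exact hc.proper u ⟨hu, hu'⟩ v ⟨hv, hv'⟩ hadj

theorem IsESColRun.correct (hG : LineMetric G) (hR : 1 ≤ R) (hℓ : Function.Injective ℓ)
    {T : ℕ → ℕ} {out : ℕ → V → Option NodeOutput} (h : IsESColRun G ℓ R T out) (t : ℕ) :
    IsLimitedRulingSet G (terminatedSet out t) (joinedSet out t) R (R - 1) ∧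
      (∃ χ : ((powerGraph G (9 * R - 1)).induce (joinedSet out t)).Coloring (Fin 17),
        ∀ v : joinedSet out t, colorAt out t v = some (χ v)) ∧
      (∀ v : V, TerminatesInRound out v t → ∃ o : NodeOutput, out t v = some o ∧
        ∀ (a : ℕ) (c : Fin 17), (a, c) ∈ o.nearby ↔
          ∃ u ∈ joinedSet out t, G.edist v u < R ∧ ℓ u = a ∧ colorAt out t u = some c) := by
  classical
  obtain ⟨hT, S, χ, htr, hout⟩ := h
  -- The last class committed by round `t`, or 0 if there is none. Index 0 may be ignored because
  -- `logStar` is at least 1.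
  obtain ⟨k, hk⟩ : ∃ k, ∀ i, 1 ≤ i → (T i ≤ t ↔ i ≤ k) := by
    by_cases h0 : T 0 ≤ t
    · have hb : ∀ i, T i ≤ t → i ≤ t := fun i hi => (hT.id_le i).trans hi
      refine ⟨Nat.findGreatest (fun i => T i ≤ t) t, fun i _ => ⟨fun hi => ?_, fun hi => ?_⟩⟩
      · exact Nat.le_findGreatest (hb i hi) hi
      · exact (hT.monotone hi).trans
          (Nat.findGreatest_spec (P := fun i => T i ≤ t) (Nat.zero_le t) h0)
    · refine ⟨0, fun i hi => ⟨fun h => ?_, fun h => by omega⟩⟩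
      exact absurd ((hT.monotone (Nat.zero_le i)).trans h) h0
  have hk' : ∀ v, T (logStar (ℓ v)) ≤ t ↔ logStar (ℓ v) ≤ k := fun v => hk _ (one_le_logStar _)
  have hterm : terminatedSet out t = {v | logStar (ℓ v) ≤ k} := by
    ext v
    simp only [terminatedSet, Set.mem_ofPred_eq, hout, ← hk' v]
    split_ifs with h <;> simp [h]
  have hsub := (htr.isSetTrace.isLimitedRulingSet hG hR hℓ k).subset
  have hmem : ∀ v, logStar (ℓ v) ≤ k → (v ∈ S (logStar (ℓ v)) ↔ v ∈ S k) := fun v hv =>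
    ⟨fun h => htr.isSetTrace.mono hv h, fun h => htr.isSetTrace.mem_of_mem hG hR hℓ h⟩
  have hcol : ∀ v, colorAt out t v = if v ∈ S k then some (χ v) else none := by
    intro v
    simp only [colorAt, hout, hk' v]
    by_cases h1 : logStar (ℓ v) ≤ k
    · simp only [h1, if_true, Option.bind_some, committedOutput, hmem v h1]
    · have h2 : v ∉ S k := fun h => h1 (hsub h)
      simp [h1, h2]
  have hjoin : joinedSet out t = S k := by
    ext v
    simp only [joinedSet, Set.mem_ofPred_eq, hcol]
    split_ifs with h <;> simp [h]
  refine ⟨?_, ?_, ?_⟩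
  · rw [hterm, hjoin]; exact htr.isSetTrace.isLimitedRulingSet hG hR hℓ k
  · rw [hjoin]
    refine ⟨SimpleGraph.Coloring.mk (fun v => χ v) ?_, ?_⟩
    · intro u v hadj
      exact htr.proper k u u.2 v v.2 hadj
    · intro v
      rw [hcol, if_pos v.2]; rfl
  · intro v hv
    have hvt : logStar (ℓ v) ≤ k := by
      have := hv.1; rw [hterm] at this; exact this
    have hTv : T (logStar (ℓ v)) ≤ t := (hk' v).mpr hvt
    have hTt : T (logStar (ℓ v)) = t := by
      by_contra hne
      refine hv.2 _ (lt_of_le_of_ne hTv hne) ?_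
      simp [terminatedSet, hout]
    -- The output of `v` lists neighbors in the set of its own class. These are all nearby joined
    -- vertices because that class is the latest one to have committed.
    have hkv : logStar (ℓ v) = k := by
      by_contra hne
      have h1 : T (logStar (ℓ v)) < T k := hT (lt_of_le_of_ne hvt hne)
      have h2 : T k ≤ t := (hk k ((one_le_logStar _).trans hvt)).mpr le_rfl
      omega
    refine ⟨_, by rw [hout, if_pos hTv], fun a c => ?_⟩
    rw [hkv, hjoin]
    simp only [committedOutput, Set.mem_ofPred_eq, Prod.mk.injEq]
    refine exists_congr fun u => and_congr_right fun hu => ?_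
    rw [edist_lt_iff_le_pred hR, hcol, if_pos hu, Option.some.injEq, @eq_comm _ a, @eq_comm _ c]

end Trace

/-! ### Locality: dependence on balls only. -/

section Agreement

/-- The graphs `H` and `H'` have the same edges at the vertices within distance less than `r`
of `a`. -/
def Agree (r a : ℕ) (H H' : SimpleGraph ℕ) : Prop :=
  ∀ x y, H.edist a x < r → (H.Adj x y ↔ H'.Adj x y)

variable {H H' : SimpleGraph ℕ} {r k a b n x : ℕ}

theorem Agree.mono (h : Agree r a H H') (hk : k ≤ r) : Agree k a H H' :=
  fun x y hx => h x y (hx.trans_le (by exact_mod_cast hk))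

/-- The case `n = r` is allowed: a shortest walk of length `r` only uses edges that start at
distance less than `r`. -/
theorem Agree.edist_le_iff (h : Agree r a H H') (hn : n ≤ r) :
    H.edist a x ≤ n ↔ H'.edist a x ≤ n := by
  induction n generalizing x with
  | zero => simp
  | succ n ih =>
    rw [edist_le_succ_iff', edist_le_succ_iff']
    refine or_congr Iff.rfl (exists_congr fun y => ?_)
    rw [← ih (by omega)]
    refine and_congr_right fun hy => h y x (hy.trans_lt ?_)
    exact_mod_cast hn

theorem Agree.symm (h : Agree r a H H') : Agree r a H' H := by
  rcases Nat.eq_zero_or_pos r with rfl | hr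
  · intro x y hx; simp at hx
  · intro x y hx
    refine (h x y ?_).symm
    rw [edist_lt_iff_le_pred hr] at hx ⊢
    exact (h.edist_le_iff (by omega)).mpr hx

theorem Agree.of_edist_le (h : Agree (r + k) a H H') (hb : H.edist a b ≤ k) :
    Agree r b H H' := by
  rcases Nat.eq_zero_or_pos r with rfl | hr
  · intro x y hx; simp at hx
  · intro x y hx
    refine h x y ?_
    rw [edist_lt_iff_le_pred hr] at hx
    refine (edist_le_add hb hx).trans_lt ?_
    exact_mod_cast (by omega : k + (r - 1) < r + k)

/-- A quantity defined at the vertices of labeled lines (whose vertices are their labels) is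
`r`-local if its value at `a` only depends on the ball of radius `r` around `a`. -/
def IsLocal {α : Type*} (r : ℕ) (F : SimpleGraph ℕ → ℕ → α) : Prop :=
  ∀ H H', LineMetric H → LineMetric H' → ∀ a, Agree r a H H' → F H a = F H' a

variable {α : Type*} {F : SimpleGraph ℕ → ℕ → α}

theorem IsLocal.mono (h : IsLocal r F) (hk : r ≤ k) : IsLocal k F :=
  fun H H' hH hH' a ha => h H H' hH hH' a (ha.mono hk)

theorem IsLocal.eq_of_edist_le (h : IsLocal r F) (hH : LineMetric H) (hH' : LineMetric H')
    (ha : Agree (r + k) a H H') (hb : H.edist a b ≤ k) : F H b = F H' b :=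
  h H H' hH hH' b (ha.of_edist_le hb)

theorem IsLocal.const (F : ℕ → α) : IsLocal r (fun _ => F) := fun _ _ _ _ _ _ => rfl

/-- The `r`-locality of a set. -/
abbrev IsLocalSet (r : ℕ) (S : SimpleGraph ℕ → Set ℕ) : Prop := IsLocal r fun H a => a ∈ S H

theorem IsLocalSet.mem_iff {S : SimpleGraph ℕ → Set ℕ} (h : IsLocalSet r S) (hH : LineMetric H)
    (hH' : LineMetric H') (ha : Agree (r + k) a H H') (hb : H.edist a b ≤ k) :
    b ∈ S H ↔ b ∈ S H' :=
  iff_of_eq (h.eq_of_edist_le hH hH' ha hb)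

/-- A bounded search in a local set is local. -/
theorem IsLocalSet.near_iff {S : SimpleGraph ℕ → Set ℕ} (h : IsLocalSet r S) (hH : LineMetric H)
    (hH' : LineMetric H') (ha : Agree (r + k) a H H') (hn : n ≤ k) :
    (b ∈ S H ∧ H.edist a b ≤ n) ↔ (b ∈ S H' ∧ H'.edist a b ≤ n) := by
  rw [← (ha.mono (Nat.le_add_left k r)).edist_le_iff hn]
  refine and_congr_left fun hb => h.mem_iff hH hH' ha (hb.trans ?_)
  exact_mod_cast hn

theorem IsLocalSet.union {S S' : SimpleGraph ℕ → Set ℕ} (h : IsLocalSet r S)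
    (h' : IsLocalSet r S') : IsLocalSet r fun H => S H ∪ S' H := by
  intro H H' hH hH' a ha
  have h1 := h H H' hH hH' a ha
  have h2 := h' H H' hH hH' a ha
  simp only [Set.mem_union] at *
  rw [h1, h2]

theorem IsLocalSet.diff {S S' : SimpleGraph ℕ → Set ℕ} (h : IsLocalSet r S)
    (h' : IsLocalSet r S') : IsLocalSet r fun H => S H \ S' H := by
  intro H H' hH hH' a ha
  have h1 := h H H' hH hH' a ha
  have h2 := h' H H' hH hH' a ha
  simp only [Set.mem_sdiff] at *
  rw [h1, h2]

theorem IsLocalSet.neighborhood {S : SimpleGraph ℕ → Set ℕ} (h : IsLocalSet r S) :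
    IsLocalSet (r + k) fun H => neighborhood H k (S H) := by
  intro H H' hH hH' a ha
  exact propext (exists_congr fun b => h.near_iff hH hH' ha le_rfl)

end Agreement

/-! ### Iterated color reduction through differing bits. -/

section ColorReduction

/-- The least position where the binary expansions of `a` and `b` differ. -/
noncomputable def differBit (a b : ℕ) : ℕ := sInf {k | a.testBit k ≠ b.testBit k}

theorem testBit_differBit_ne {a b : ℕ} (h : a ≠ b) :
    a.testBit (differBit a b) ≠ b.testBit (differBit a b) := by
  have : {k | a.testBit k ≠ b.testBit k}.Nonempty := by
    by_contra hc
    rw [Set.not_nonempty_iff_eq_empty] at hc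
    refine h (Nat.eq_of_testBit_eq fun i => ?_)
    by_contra hi
    have : i ∈ {k | a.testBit k ≠ b.testBit k} := hi
    rw [hc] at this
    exact this
  exact Nat.sInf_mem this

theorem differBit_lt {a b m : ℕ} (h : a ≠ b) (ha : a < 2 ^ m) (hb : b < 2 ^ m) :
    differBit a b < m := by
  by_contra hm
  have hle : 2 ^ m ≤ 2 ^ differBit a b := Nat.pow_le_pow_right (by norm_num) (by omega)
  apply testBit_differBit_ne h
  rw [Nat.testBit_lt_two_pow (ha.trans_le hle), Nat.testBit_lt_two_pow (hb.trans_le hle)]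

/-- The position of a bit where `a` differs from `b`, together with that bit of `a`. -/
noncomputable def bitMark (a b : ℕ) : ℕ :=
  2 * differBit a b + (a.testBit (differBit a b)).toNat

theorem bitMark_lt {a b m : ℕ} (h : a ≠ b) (ha : a < 2 ^ m) (hb : b < 2 ^ m) :
    bitMark a b < 2 * m := by
  have h1 := differBit_lt h ha hb
  have h2 := Bool.toNat_le (a.testBit (differBit a b))
  unfold bitMark
  omega

/-- Equal marks would name the same position and the same bit of `a` and `b` there, although the
position was chosen where they differ. As `c` is arbitrary, whole sets of marks can be compared. -/
theorem bitMark_ne {a b c : ℕ} (h : a ≠ b) : bitMark a b ≠ bitMark b c := by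
  intro he
  have h1 := Bool.toNat_le (a.testBit (differBit a b))
  have h2 := Bool.toNat_le (b.testBit (differBit b c))
  unfold bitMark at he
  have h3 : differBit a b = differBit b c := by omega
  have h4 : (a.testBit (differBit a b)).toNat = (b.testBit (differBit b c)).toNat := by omega
  rw [← h3] at h4
  exact testBit_differBit_ne h (by
    revert h4
    cases a.testBit (differBit a b) <;> cases b.testBit (differBit a b) <;> simp)

open Classical in
/-- A code for the nonempty subsets of `{0, …, B - 1}` with at most `Δ` elements. -/
noncomputable def setCode (Δ B : ℕ) (A : Set ℕ) : ℕ :=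
  if h : ∃ f : Fin Δ → Fin B, A = Set.range fun j => (f j : ℕ) then
    finFunctionFinEquiv h.choose else 0

theorem setCode_lt {Δ B N : ℕ} (hN : 0 < N) (hB : B ^ Δ ≤ N) (A : Set ℕ) :
    setCode Δ B A < N := by
  unfold setCode
  split_ifs with h
  · exact (finFunctionFinEquiv h.choose).2.trans_le hB
  · exact hN

/-- Repeated values let one function type encode sets of different sizes. The empty set may fall
under the default value of `setCode`, which is harmless: a vertex without marks has no neighbors to
conflict with. -/
theorem exists_range_eq {Δ B : ℕ} {A : Set ℕ} (hA : A.Nonempty) (hfin : A.Finite)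
    (hcard : A.ncard ≤ Δ) (hB : ∀ z ∈ A, z < B) :
    ∃ f : Fin Δ → Fin B, A = Set.range fun j => (f j : ℕ) := by
  classical
  have := hfin.fintype
  have hc : Fintype.card A ≤ Fintype.card (Fin Δ) := by
    rwa [Fintype.card_fin, ← Nat.card_eq_fintype_card, Nat.card_coe_set_eq]
  obtain ⟨g⟩ := Function.Embedding.nonempty_of_card_le hc
  have : Nonempty A := hA.to_subtype
  have hs : Function.Surjective (Function.invFun g) := Function.invFun_surjective g.injective
  refine ⟨fun j => ⟨(Function.invFun g j).1, hB _ (Function.invFun g j).2⟩, ?_⟩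
  ext z
  constructor
  · intro hz
    obtain ⟨j, hj⟩ := hs ⟨z, hz⟩
    exact ⟨j, by simp [hj]⟩
  · rintro ⟨j, rfl⟩
    exact (Function.invFun g j).2

theorem setCode_inj {Δ B : ℕ} {A A' : Set ℕ}
    (hA : ∃ f : Fin Δ → Fin B, A = Set.range fun j => (f j : ℕ))
    (hA' : ∃ f : Fin Δ → Fin B, A' = Set.range fun j => (f j : ℕ))
    (h : setCode Δ B A = setCode Δ B A') : A = A' := by
  unfold setCode at h
  rw [dif_pos hA, dif_pos hA'] at h
  have := finFunctionFinEquiv.injective (Fin.ext h)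
  rw [hA.choose_spec, hA'.choose_spec, this]

/-- The marks that distinguish the color of `x` from those of its neighbors in `H ^ k [U]`. -/
def colorMarks (k : ℕ) (H : SimpleGraph ℕ) (U : Set ℕ) (c : ℕ → ℕ) (x : ℕ) : Set ℕ :=
  {z | ∃ y, y ≠ x ∧ (y ∈ U ∧ H.edist x y ≤ k) ∧ z = bitMark (c x) (c y)}

/-- Iterated color reduction on `H ^ k [U]`, for vertices with `log* = i`: one round reduces the
colors of `m` bits to colors of `O(log m)` bits. -/
noncomputable def reducedColor (k i : ℕ) (U : SimpleGraph ℕ → Set ℕ) :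
    ℕ → SimpleGraph ℕ → ℕ → ℕ
  | 0, _, x => x
  | s + 1, H, x =>
    setCode 24 (2 * (512 * tower (i - 1 - s))) (colorMarks k H (U H) (reducedColor k i U s H) x)

/-- The number of colors that remain after color reduction. -/
@[irreducible] def paletteSize : ℕ := 2 ^ (512 * tower 0)

theorem paletteSize_eq : 2 ^ (512 * tower 0) = paletteSize := by
  unfold paletteSize
  exact Eq.refl _

/-- The factor `512` turns all quantities into powers of two and satisfies `24 * (10 + tower j) ≤
512 * tower j`. At `j = 0` the bound reproduces itself, so surplus rounds do no harm. -/
theorem reduced_palette_le (j : ℕ) :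
    (2 * (512 * tower j)) ^ 24 ≤ 2 ^ (512 * tower (j - 1)) := by
  cases j with
  | zero =>
    rw [show 2 * (512 * tower 0) = 2 ^ 10 from rfl, ← pow_mul]
    exact Nat.pow_le_pow_right (by norm_num) (by norm_num [tower])
  | succ j =>
    have h1 := one_le_tower j
    have h2 : 2 * (512 * tower (j + 1)) = 2 ^ (10 + tower j) := by
      rw [pow_add]; simp only [tower]; ring
    rw [h2, ← pow_mul]
    refine Nat.pow_le_pow_right (by norm_num) ?_
    simp only [Nat.add_sub_cancel]
    omega

/-- If neighbors `x`, `y` received the same code, the mark of `x` against `y` would also be a mark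
of `y` against some `z`, contrary to `bitMark_ne`. The degree 24 is the largest needed: the packing
bound for radius `12 * R` in an `R`-separated set. -/
theorem reducedColor_spec {k i : ℕ} {U : SimpleGraph ℕ → Set ℕ} {H : SimpleGraph ℕ}
    (hU : ∀ x ∈ U H, logStar x = i)
    (hdeg : ∀ x ∈ U H, {y ∈ U H | y ≠ x ∧ H.edist x y ≤ k}.Finite ∧
      {y ∈ U H | y ≠ x ∧ H.edist x y ≤ k}.ncard ≤ 24) (s : ℕ) :
    (∀ x ∈ U H, reducedColor k i U s H x < 2 ^ (512 * tower (i - 1 - s))) ∧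
    ∀ x ∈ U H, ∀ y ∈ U H, x ≠ y → H.edist x y ≤ k →
      reducedColor k i U s H x ≠ reducedColor k i U s H y := by
  induction s with
  | zero =>
    refine ⟨fun x hx => ?_, fun x _ y _ h _ => h⟩
    have h1 := one_le_logStar x
    have h2 := hU x hx
    have h3 : x ≤ tower (i - 1) := by
      exact_mod_cast le_tower_of_logStar_le (i - 1) x (by omega)
    calc x ≤ tower (i - 1) := h3
      _ ≤ 512 * tower (i - 1) := by omega
      _ < 2 ^ (512 * tower (i - 1)) := Nat.lt_two_pow_self
  | succ s ih =>
    obtain ⟨ih1, ih2⟩ := ih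
    have hrange : ∀ x ∈ U H, ∀ y ∈ U H, x ≠ y → H.edist x y ≤ k →
        ∃ f : Fin 24 → Fin (2 * (512 * tower (i - 1 - s))),
          colorMarks k H (U H) (reducedColor k i U s H) x = Set.range fun j => (f j : ℕ) := by
      intro x hx y hy hxy hd
      obtain ⟨hf, hc⟩ := hdeg x hx
      have hsub : colorMarks k H (U H) (reducedColor k i U s H) x =
          (fun y => bitMark (reducedColor k i U s H x) (reducedColor k i U s H y)) ''
            {y ∈ U H | y ≠ x ∧ H.edist x y ≤ k} := by
        ext z
        constructor
        · rintro ⟨y, h1, ⟨h2, h3⟩, rfl⟩; exact ⟨y, ⟨h2, h1, h3⟩, rfl⟩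
        · rintro ⟨y, ⟨h2, h1, h3⟩, rfl⟩; exact ⟨y, h1, ⟨h2, h3⟩, rfl⟩
      refine exists_range_eq ⟨_, y, hxy.symm, ⟨hy, hd⟩, rfl⟩ ?_ ?_ ?_
      · rw [hsub]; exact hf.image _
      · rw [hsub]; exact (Set.ncard_image_le hf).trans hc
      · rintro z ⟨y, h1, ⟨h2, h3⟩, rfl⟩
        exact bitMark_lt (ih2 x hx y h2 h1.symm h3) (ih1 x hx) (ih1 y h2)
    refine ⟨fun x _ => ?_, fun x hx y hy hxy hd he => ?_⟩
    · refine setCode_lt (by positivity) ?_ _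
      rw [← Nat.sub_sub]
      exact reduced_palette_le _
    · have hd' : H.edist y x ≤ k := by rwa [SimpleGraph.edist_comm]
      have hA := setCode_inj (hrange x hx y hy hxy hd) (hrange y hy x hx hxy.symm hd') he
      have hm : bitMark (reducedColor k i U s H x) (reducedColor k i U s H y) ∈
          colorMarks k H (U H) (reducedColor k i U s H) x := ⟨y, hxy.symm, ⟨hy, hd⟩, rfl⟩
      rw [hA] at hm
      obtain ⟨z, -, -, hz⟩ := hm
      exact bitMark_ne (ih2 x hx y hy hxy hd) hz

theorem reducedColor_isLocal {r k i : ℕ} {U : SimpleGraph ℕ → Set ℕ} (hU : IsLocalSet r U)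
    (s : ℕ) : IsLocal (r + k * s) (reducedColor k i U s) := by
  induction s with
  | zero => exact IsLocal.const _
  | succ s ih =>
    intro H H' hH hH' a ha
    rw [show r + k * (s + 1) = r + k * s + k by ring] at ha
    simp only [reducedColor]
    congr 1
    ext z
    refine exists_congr fun y => and_congr_right fun _ => ?_
    have h1 : reducedColor k i U s H a = reducedColor k i U s H' a :=
      ih.eq_of_edist_le hH hH' ha (by simp)
    rw [h1, ← IsLocalSet.near_iff (hU.mono (Nat.le_add_right r (k * s))) hH hH' ha le_rfl]
    refine and_congr_right fun hy => ?_
    rw [ih.eq_of_edist_le hH hH' ha hy.2]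

end ColorReduction

/-! ### Local maximal independent sets from colorings. -/

section MaximalIndependentSet

/-- The greedy independent set of `H ^ k [U]`, where the color classes of `c` are treated one
after the other. -/
def greedyIndepSet (k : ℕ) (U : SimpleGraph ℕ → Set ℕ) (c : SimpleGraph ℕ → ℕ → ℕ) :
    ℕ → SimpleGraph ℕ → Set ℕ
  | 0, _ => ∅
  | q + 1, H => greedyIndepSet k U c q H ∪
      {x | x ∈ U H ∧ c H x = q ∧ ¬ ∃ y, y ∈ greedyIndepSet k U c q H ∧ H.edist x y ≤ k}

theorem greedyIndepSet_spec {k : ℕ} {U : SimpleGraph ℕ → Set ℕ} {c : SimpleGraph ℕ → ℕ → ℕ}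
    {H : SimpleGraph ℕ}
    (hc : ∀ x ∈ U H, ∀ y ∈ U H, x ≠ y → H.edist x y ≤ k → c H x ≠ c H y) (q : ℕ) :
    greedyIndepSet k U c q H ⊆ U H ∧
    (∀ x ∈ greedyIndepSet k U c q H, ∀ y ∈ greedyIndepSet k U c q H, x ≠ y →
      ¬ H.edist x y ≤ k) ∧
    ∀ x ∈ U H, c H x < q → ∃ y ∈ greedyIndepSet k U c q H, H.edist x y ≤ k := by
  induction q with
  | zero => exact ⟨by simp [greedyIndepSet], by simp [greedyIndepSet], by simp⟩
  | succ q ih =>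
    obtain ⟨h1, h2, h3⟩ := ih
    refine ⟨Set.union_subset h1 fun x hx => hx.1, ?_, ?_⟩
    · rintro x (hx | hx) y (hy | hy) hxy
      · exact h2 x hx y hy hxy
      · exact fun hd => hy.2.2 ⟨x, hx, by rwa [SimpleGraph.edist_comm]⟩
      · exact fun hd => hx.2.2 ⟨y, hy, hd⟩
      · exact fun hd => hc x hx.1 y hy.1 hxy hd (hx.2.1.trans hy.2.1.symm)
    · intro x hx hxq
      by_cases hex : ∃ y, y ∈ greedyIndepSet k U c q H ∧ H.edist x y ≤ k
      · obtain ⟨y, hy, hd⟩ := hex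
        exact ⟨y, Or.inl hy, hd⟩
      · have hq : c H x = q := by
          by_contra hne
          obtain ⟨y, hy, hd⟩ := h3 x hx (by omega)
          exact hex ⟨y, hy, hd⟩
        exact ⟨x, Or.inr ⟨hx, hq, hex⟩, by simp⟩

theorem greedyIndepSet_isLocal {r k : ℕ} {U : SimpleGraph ℕ → Set ℕ}
    {c : SimpleGraph ℕ → ℕ → ℕ} (hU : IsLocalSet r U) (hc : IsLocal r c) (q : ℕ) :
    IsLocalSet (r + k * q) (greedyIndepSet k U c q) := by
  induction q with
  | zero => intro H H' _ _ a _; rfl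
  | succ q ih =>
    intro H H' hH hH' a ha
    rw [show r + k * (q + 1) = r + k * q + k by ring] at ha
    have ha' : Agree r a H H' := ha.mono (by rw [add_assoc]; exact Nat.le_add_right _ _)
    have h1 := ih.mem_iff hH hH' ha (b := a) (by simp)
    have h2 := hU H H' hH hH' a ha'
    have h3 := hc H H' hH hH' a ha'
    have h4 := fun b => ih.near_iff hH hH' ha (b := b) le_rfl
    simp only at h2
    simp only [greedyIndepSet, Set.mem_union, Set.mem_ofPred_eq, h1, h2, h3, h4]

/-- A maximal independent set of `H ^ k [U]`, for vertices with `log* = i`. -/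
noncomputable def localMIS (k i : ℕ) (U : SimpleGraph ℕ → Set ℕ) : SimpleGraph ℕ → Set ℕ :=
  greedyIndepSet k U (reducedColor k i U i) paletteSize

theorem reducedColor_lt_paletteSize {k i : ℕ} {U : SimpleGraph ℕ → Set ℕ} {H : SimpleGraph ℕ}
    (hU : ∀ x ∈ U H, logStar x = i)
    (hdeg : ∀ x ∈ U H, {y ∈ U H | y ≠ x ∧ H.edist x y ≤ k}.Finite ∧
      {y ∈ U H | y ≠ x ∧ H.edist x y ≤ k}.ncard ≤ 24) {x : ℕ} (hx : x ∈ U H) :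
    reducedColor k i U i H x < paletteSize := by
  have h := (reducedColor_spec hU hdeg i).1 x hx
  rw [show i - 1 - i = 0 by omega] at h
  exact h.trans_eq paletteSize_eq

theorem localMIS_isMISOn {k i : ℕ} {U : SimpleGraph ℕ → Set ℕ} {H : SimpleGraph ℕ}
    (hU : ∀ x ∈ U H, logStar x = i)
    (hdeg : ∀ x ∈ U H, {y ∈ U H | y ≠ x ∧ H.edist x y ≤ k}.Finite ∧
      {y ∈ U H | y ≠ x ∧ H.edist x y ≤ k}.ncard ≤ 24) :
    IsMISOn (powerGraph H k) (U H) (localMIS k i U H) := by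
  obtain ⟨h1, h2, h3⟩ := greedyIndepSet_spec (reducedColor_spec hU hdeg i).2 paletteSize
  change IsMISOn _ _ (greedyIndepSet k U (reducedColor k i U i) paletteSize H)
  refine ⟨h1, fun x hx y hy hadj => h2 x hx y hy hadj.1 hadj.2, fun x hx hx' => ?_⟩
  obtain ⟨y, hy, hd⟩ := h3 x hx (reducedColor_lt_paletteSize hU hdeg hx)
  exact ⟨y, hy, fun h => hx' (h ▸ hy), hd⟩

theorem localMIS_isLocal {r k i : ℕ} {U : SimpleGraph ℕ → Set ℕ} (hU : IsLocalSet r U) :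
    IsLocalSet (r + k * (i + paletteSize)) (localMIS k i U) := by
  have h := greedyIndepSet_isLocal (k := k) (hU.mono (Nat.le_add_right r (k * i)))
    (reducedColor_isLocal (k := k) (i := i) hU i) paletteSize
  rwa [add_assoc, ← mul_add] at h

end MaximalIndependentSet

/-! ### Locality of greedy steps. -/

section LocalGreedy

variable {r R : ℕ} {U : Set ℕ} {S : SimpleGraph ℕ → Set ℕ}

/-- In general no ball reveals the distance to a set. The covering hypothesis bounds it by `3 * R`
on `U`, and then a bounded search determines it. -/
theorem distToSet_eq_of_agree (hS : IsLocalSet r S)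
    (hcov : ∀ H, LineMetric H → ∀ v ∈ U, ∃ s ∈ S H, H.edist v s < (3 * R : ℕ))
    {H H' : SimpleGraph ℕ} (hH : LineMetric H) (hH' : LineMetric H') {u : ℕ} (hu : u ∈ U)
    (ha : Agree (r + 3 * R) u H H') :
    distToSet H (S H) u = distToSet H' (S H') u := by
  have key : ∀ n ≤ 3 * R, distToSet H (S H) u ≤ n ↔ distToSet H' (S H') u ≤ n := by
    intro n hn
    rw [distToSet_le_iff, distToSet_le_iff]
    exact exists_congr fun s => hS.near_iff hH hH' ha hn
  have hfin : ∀ K, LineMetric K → ∃ n ≤ 3 * R, distToSet K (S K) u = n := by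
    intro K hK
    obtain ⟨s, hs, hd⟩ := hcov K hK u hu
    have h1 : distToSet K (S K) u ≤ (3 * R : ℕ) := distToSet_le_iff.mpr ⟨s, hs, hd.le⟩
    obtain ⟨n, hn⟩ := ENat.ne_top_iff_exists.mp
      (ne_top_of_le_ne_top (ENat.natCast_ne_top (3 * R)) h1)
    rw [← hn] at h1
    exact ⟨n, by exact_mod_cast h1, hn.symm⟩
  obtain ⟨n, hn, en⟩ := hfin H hH
  obtain ⟨n', hn', en'⟩ := hfin H' hH'
  refine le_antisymm ?_ ?_
  · rw [en']; exact (key n' hn').mpr en'.le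
  · rw [en]; exact (key n hn).mp en.le

/-- Rivals are found within distance `R`, and their distances to the set within a further `3 * R`.
-/
theorem greedyStep_isLocal (hS : IsLocalSet r S)
    (hcov : ∀ H, LineMetric H → ∀ v ∈ U, ∃ s ∈ S H, H.edist v s < (3 * R : ℕ)) :
    IsLocalSet (r + 4 * R) fun H => greedyStep H id U R (S H) := by
  intro H H' hH hH' a ha
  rw [show r + 4 * R = r + 3 * R + R by ring] at ha
  have hball : ∀ b, H.edist a b ≤ R →
      (b ∈ candidates H U R (S H) ↔ b ∈ candidates H' U R (S H')) ∧
        (b ∈ U → distToSet H (S H) b = distToSet H' (S H') b) := by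
    intro b hb
    have h1 : b ∈ U → distToSet H (S H) b = distToSet H' (S H') b := fun hbU =>
      distToSet_eq_of_agree hS hcov hH hH' hbU (ha.of_edist_le hb)
    refine ⟨and_congr_right fun hbU => ?_, h1⟩
    rw [h1 hbU]
  have h0 := (hball a (by simp)).1
  have hd0 := (hball a (by simp)).2
  have hR : ((R - 1 : ℕ) : ℕ∞) ≤ R := by exact_mod_cast Nat.sub_le R 1
  refine propext (or_congr ?_ ?_)
  · exact hS.mem_iff hH hH' (k := 3 * R + R) (by rwa [← add_assoc]) (by simp)
  · constructor
    · rintro ⟨h1, h2⟩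
      refine ⟨h0.mp h1, fun u hu hne hd => ?_⟩
      have hd' : H.edist a u ≤ ((R - 1 : ℕ) : ℕ∞) :=
        ((ha.mono (Nat.le_add_left R _)).edist_le_iff (Nat.sub_le R 1)).mpr hd
      have hb := hball u (hd'.trans hR)
      rw [← hb.2 hu.1, ← hd0 h1.1]
      exact h2 u (hb.1.mpr hu) hne hd'
    · rintro ⟨h1, h2⟩
      have h1' := h0.mpr h1
      refine ⟨h1', fun u hu hne hd => ?_⟩
      have hb := hball u (hd.trans hR)
      rw [hb.2 hu.1, hd0 h1.1]
      exact h2 u (hb.1.mp hu) hne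
        (((ha.mono (Nat.le_add_left R _)).edist_le_iff (Nat.sub_le R 1)).mp hd)

theorem greedyStep_iterate_isLocal (hS : IsLocalSet r S)
    (hcov : ∀ H, LineMetric H → ∀ v ∈ U, ∃ s ∈ S H, H.edist v s < (3 * R : ℕ)) (n : ℕ) :
    IsLocalSet (r + 4 * R * n) fun H => (greedyStep H id U R)^[n] (S H) := by
  induction n with
  | zero => exact hS
  | succ n ih =>
    have h := greedyStep_isLocal (R := R) (U := U) ih fun H hH v hv => by
      obtain ⟨s, hs, hd⟩ := hcov H hH v hv
      exact ⟨s, subset_greedyStep_iterate n hs, hd⟩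
    simp only [Function.iterate_succ_apply']
    rwa [add_assoc, ← Nat.mul_succ] at h

end LocalGreedy

/-! ### Local versions of the sets of both procedures. -/

section LocalRulingSet

/-- The chain of maximal independent sets in `PathRulingSet` on the vertices with `log* = i`. -/
noncomputable def misChain (R i : ℕ) : ℕ → SimpleGraph ℕ → Set ℕ
  | 0, _ => labelClass id i
  | j + 1, H => localMIS (misRadius R (j + 1)) i (misChain R i j) H

theorem misChain_isLocal (R i j : ℕ) :
    IsLocalSet (misRadiusSum R j * (i + paletteSize)) (misChain R i j) := by
  induction j with
  | zero => exact IsLocal.const _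
  | succ j ih =>
    have h := localMIS_isLocal (k := misRadius R (j + 1)) (i := i) ih
    rwa [← add_mul, ← show misRadiusSum R (j + 1) = misRadiusSum R j + misRadius R (j + 1) from
      Finset.sum_range_succ _ _] at h

/-- This is what the doubling of the radii is for: the `j`-th set is `2 ^ j`-separated and the next
radius is below `2 * 2 ^ j`, so at most two neighbors compete and `localMIS` applies. -/
theorem misChain_spec {R i : ℕ} {H : SimpleGraph ℕ} (hH : LineMetric H) (j : ℕ)
    (hj : j ≤ Nat.clog 2 R) :
    (∀ l, 1 ≤ l → l ≤ j → IsMISOn (powerGraph H (misRadius R l)) (misChain R i (l - 1) H)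
      (misChain R i l H)) := by
  induction j with
  | zero => intro l h1 h2; omega
  | succ j ih =>
    have ih := ih (by omega)
    intro l h1 h2
    rcases Nat.lt_or_ge j l with h | h
    swap
    · exact ih l h1 h
    obtain rfl : l = j + 1 := by omega
    rw [Nat.add_sub_cancel]
    have hsub : misChain R i j H ⊆ labelClass id i :=
      misChain_subset (M := fun l => misChain R i l H) rfl ih
    have hpack : ∀ u ∈ misChain R i j H, ∀ w ∈ misChain R i j H, u ≠ w →
        ((2 ^ j : ℕ) : ℕ∞) ≤ H.edist u w := by
      intro u hu w hw huw
      rcases Nat.eq_zero_or_pos j with rfl | hj0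
      · rw [pow_zero, Nat.cast_one, Order.one_le_iff_pos]
        exact SimpleGraph.edist_pos_of_ne huw
      · have h3 := (ih j hj0 le_rfl).lt_edist u hu w hw huw
        rwa [show misRadius R j = 2 ^ j - 1 from if_pos hj,
          Nat.sub_add_cancel Nat.one_le_two_pow] at h3
    have hrad : misRadius R (j + 1) < (1 + 1) * 2 ^ j := by
      have h1 : 1 ≤ 2 ^ j := Nat.one_le_two_pow
      have h4 : 2 ^ (j + 1) = 2 * 2 ^ j := by ring
      unfold misRadius
      split_ifs with h
      · omega
      · have h2 := Nat.le_pow_clog (b := 2) (by norm_num) R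
        rw [show Nat.clog 2 R = j + 1 by omega] at h2
        omega
    refine localMIS_isMISOn (fun x hx => hsub hx) fun x hx => ?_
    have := hH.ncard_packing_le Nat.one_le_two_pow hpack hrad hx
    exact ⟨this.1, this.2.trans (by norm_num)⟩

/-- The result of `PathRulingSet` on the vertices with `log* = i`. -/
noncomputable def pathSet (R i : ℕ) (H : SimpleGraph ℕ) : Set ℕ :=
  (greedyStep H id (labelClass id i) R)^[6] (misChain R i (Nat.clog 2 R) H)

theorem pathSet_isResult {R i : ℕ} {H : SimpleGraph ℕ} (hH : LineMetric H) :
    IsPathRulingSetResult H id (labelClass id i) R (pathSet R i H) :=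
  ⟨fun l => misChain R i l H, rfl, misChain_spec hH _ le_rfl, rfl⟩

theorem pathSet_isLimitedRulingSet {R i : ℕ} {H : SimpleGraph ℕ} (hH : LineMetric H)
    (hR : 1 ≤ R) : IsLimitedRulingSet H (labelClass id i) (pathSet R i H) R (R - 1) :=
  (pathSet_isResult hH).isLimitedRulingSet hH hR Function.injective_id
    (finite_labelClass Function.injective_id i)

theorem pathSet_isLocal {R i : ℕ} (hR : 1 ≤ R) :
    IsLocalSet (3 * R * (i + paletteSize) + 24 * R) (pathSet R i) := by
  have h := greedyStep_iterate_isLocal (R := R) (U := labelClass id i)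
    (misChain_isLocal R i (Nat.clog 2 R)) (fun H hH v hv => by
      obtain ⟨s, hs, hd⟩ := misChain_covering (M := fun l => misChain R i l H) rfl
        (misChain_spec hH _ le_rfl) v hv
      exact ⟨s, hs, lt_of_le_of_lt hd (by exact_mod_cast misRadiusSum_lt hR)⟩) 6
  refine IsLocal.mono h ?_
  have := Nat.mul_le_mul_right (i + paletteSize) (misRadiusSum_lt hR).le
  omega

/-- A coloring of the result of `PathRulingSet` with few colors, proper up to distance `12 R`. -/
noncomputable def rulerColor (R i : ℕ) : SimpleGraph ℕ → ℕ → ℕ :=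
  reducedColor (12 * R) i (pathSet R i) i

/-- This coloring does not refer to earlier classes, so its radius `O(R i)` is not paid anew on top
of theirs. -/
theorem rulerColor_spec {R i : ℕ} {H : SimpleGraph ℕ} (hH : LineMetric H) (hR : 1 ≤ R) :
    (∀ x ∈ pathSet R i H, rulerColor R i H x < paletteSize) ∧
    ∀ x ∈ pathSet R i H, ∀ y ∈ pathSet R i H, x ≠ y → H.edist x y ≤ (12 * R : ℕ) →
      rulerColor R i H x ≠ rulerColor R i H y := by
  have hP := pathSet_isLimitedRulingSet (i := i) hH hR
  have hdeg : ∀ x ∈ pathSet R i H,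
      {y ∈ pathSet R i H | y ≠ x ∧ H.edist x y ≤ (12 * R : ℕ)}.Finite ∧
      {y ∈ pathSet R i H | y ≠ x ∧ H.edist x y ≤ (12 * R : ℕ)}.ncard ≤ 24 := fun x hx =>
    hH.ncard_packing_le (q := 12) hR hP.packing (by omega) hx
  exact ⟨fun x hx => reducedColor_lt_paletteSize (fun x hx => hP.subset hx) hdeg hx,
    (reducedColor_spec (fun x hx => hP.subset hx) hdeg i).2⟩

theorem rulerColor_isLocal {R i : ℕ} (hR : 1 ≤ R) :
    IsLocal (3 * R * (i + paletteSize) + 24 * R + 12 * R * i) (rulerColor R i) :=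
  reducedColor_isLocal (pathSet_isLocal hR) i

/-- The set computed by `ES-ColPathRulingSet` after `V_1, …, V_i` have been treated. -/
noncomputable def esSet (R : ℕ) : ℕ → SimpleGraph ℕ → Set ℕ
  | 0, _ => ∅
  | i + 1, H => (greedyStep H id (labelClass id (i + 1)) R)^[4]
      (esSet R i H ∪ (pathSet R (i + 1) H \ neighborhood H (R - 1) (esSet R i H)))

theorem esSet_isSetTrace {R : ℕ} {H : SimpleGraph ℕ} (hH : LineMetric H) :
    IsSetTrace H id R fun i => esSet R i H where
  start := rfl
  extend i hi := by
    obtain ⟨j, rfl⟩ : ∃ j, i = j + 1 := ⟨i - 1, by omega⟩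
    exact ⟨pathSet R (j + 1) H, pathSet_isResult hH, rfl⟩

/-- Removing the neighborhood costs at most `R` and four greedy steps cost `16 * R`; the increment
is independent of `i`. -/
theorem esSet_succ_isLocal {R i r : ℕ} (hR : 1 ≤ R) (hS : IsLocalSet r (esSet R i))
    (hP : IsLocalSet r (pathSet R (i + 1))) : IsLocalSet (r + 17 * R) (esSet R (i + 1)) := by
  have h1 : IsLocalSet (r + R) fun H =>
      esSet R i H ∪ (pathSet R (i + 1) H \ neighborhood H (R - 1) (esSet R i H)) := by
    refine IsLocalSet.union (hS.mono (Nat.le_add_right _ _))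
      (IsLocalSet.diff (hP.mono (Nat.le_add_right _ _)) ?_)
    exact IsLocal.mono (IsLocalSet.neighborhood hS) (by omega)
  refine IsLocal.mono (greedyStep_iterate_isLocal (R := R) (U := labelClass id (i + 1)) h1
    (fun H hH => merge_covering hR (pathSet_isLimitedRulingSet hH hR)) 4) (by omega)

end LocalRulingSet

/-! ### Local list coloring of the new vertices. -/

section LocalColoring

/-- The vertices that join while `V_{i+1}` is treated. -/
noncomputable def newSet (R i : ℕ) (H : SimpleGraph ℕ) : Set ℕ := esSet R (i + 1) H \ esSet R i H

/-- The least member of the result of `PathRulingSet` on `V_{i+1}` near `x`. -/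
noncomputable def owner (R i : ℕ) (H : SimpleGraph ℕ) (x : ℕ) : ℕ :=
  sInf {p | p ∈ pathSet R (i + 1) H ∧ H.edist x p ≤ ((R - 1 : ℕ) : ℕ∞)}

/-- Some new vertex with a smaller label has the same owner. -/
def IsSecond (R i : ℕ) (H : SimpleGraph ℕ) (x : ℕ) : Prop :=
  ∃ z, z < x ∧ (z ∈ newSet R i H ∧ H.edist x z ≤ (2 * R : ℕ)) ∧ owner R i H z = owner R i H x

open Classical in
/-- The position of `x` in the order in which the new vertices are colored. -/
noncomputable def priority (R i : ℕ) (H : SimpleGraph ℕ) (x : ℕ) : ℕ :=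
  if logStar x = i + 1 then
    2 * rulerColor R (i + 1) H (owner R i H x) + (if IsSecond R i H x then 1 else 0)
  else 0

/-- Some color outside the given set. -/
noncomputable def freeColor (A : Set (Fin 17)) : Fin 17 := Classical.epsilon fun c => c ∉ A

theorem freeColor_notMem {A : Set (Fin 17)} (h : A.ncard ≤ 16) : freeColor A ∉ A := by
  refine Classical.epsilon_spec (p := fun c => c ∉ A) ?_
  by_contra! hc
  rw [Set.eq_univ_of_forall hc, Set.ncard_univ] at h
  simp at h

/-- The colors that `x` has to avoid in step `q` of the coloring of the new vertices. -/
def usedColors (R i q : ℕ) (χ : ℕ → Fin 17) (H : SimpleGraph ℕ) (x : ℕ) : Set (Fin 17) :=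
  {a | ∃ w, w ≠ x ∧ (w ∈ esSet R (i + 1) H ∧ H.edist x w ≤ (9 * R - 1 : ℕ)) ∧
    (w ∈ esSet R i H ∨ priority R i H w < q) ∧ χ w = a}

open Classical in
/-- Coloring of the new vertices in the order of their priorities. -/
noncomputable def extendColor (R i : ℕ) (χ : SimpleGraph ℕ → ℕ → Fin 17) :
    ℕ → SimpleGraph ℕ → ℕ → Fin 17
  | 0, H, x => χ H x
  | q + 1, H, x =>
    if x ∈ newSet R i H ∧ priority R i H x = q then
      freeColor (usedColors R i q (extendColor R i χ q H) H x)
    else extendColor R i χ q H x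

/-- The coloring computed by `ES-ColPathRulingSet` after `V_1, …, V_i` have been treated. -/
noncomputable def esColor (R : ℕ) : ℕ → SimpleGraph ℕ → ℕ → Fin 17
  | 0, _, _ => 0
  | i + 1, H, x => extendColor R i (esColor R i) (2 * paletteSize) H x

theorem esColor_succ (R i : ℕ) :
    esColor R (i + 1) = extendColor R i (esColor R i) (2 * paletteSize) := by
  funext H x
  rw [esColor]

section Spec

variable {R i : ℕ} {H : SimpleGraph ℕ}

theorem logStar_eq_of_mem_newSet (hH : LineMetric H) (hR : 1 ≤ R) {x : ℕ}
    (hx : x ∈ newSet R i H) : logStar x = i + 1 :=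
  (esSet_isSetTrace hH).logStar_eq_of_mem_diff hH hR Function.injective_id hx.1 hx.2

theorem owner_spec (hH : LineMetric H) (hR : 1 ≤ R) {x : ℕ} (hx : logStar x = i + 1) :
    owner R i H x ∈ pathSet R (i + 1) H ∧ H.edist x (owner R i H x) ≤ ((R - 1 : ℕ) : ℕ∞) :=
  Nat.sInf_mem ((pathSet_isLimitedRulingSet (i := i + 1) hH hR).covering x hx)

theorem priority_lt (hH : LineMetric H) (hR : 1 ≤ R) {x : ℕ} (hx : logStar x = i + 1) :
    priority R i H x < 2 * paletteSize := by
  have h := (rulerColor_spec (i := i + 1) hH hR).1 _ (owner_spec hH hR hx).1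
  unfold priority
  rw [if_pos hx]
  split_ifs <;> omega

/-- Owners of new vertices within distance `9 * R - 1` are within `12 * R`, so equal ruler colors
mean equal owners. At most two new vertices share an owner, and `IsSecond` tells them apart. -/
theorem priority_ne (hH : LineMetric H) (hR : 1 ≤ R) {x y : ℕ} (hx : x ∈ newSet R i H)
    (hy : y ∈ newSet R i H) (hxy : x ≠ y) (hd : H.edist x y ≤ (9 * R - 1 : ℕ)) :
    priority R i H x ≠ priority R i H y := by
  have key : ∀ x ∈ newSet R i H, ∀ y ∈ newSet R i H, x < y → H.edist x y ≤ (9 * R - 1 : ℕ) →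
      priority R i H x ≠ priority R i H y := by
    intro x hx y hy hxy hd he
    have lx := logStar_eq_of_mem_newSet hH hR hx
    have ly := logStar_eq_of_mem_newSet hH hR hy
    obtain ⟨ox, dx⟩ := owner_spec hH hR lx
    obtain ⟨oy, dy⟩ := owner_spec hH hR ly
    have dx' : H.edist (owner R i H x) x ≤ ((R - 1 : ℕ) : ℕ∞) := by
      rwa [SimpleGraph.edist_comm]
    have dy' : H.edist (owner R i H y) y ≤ ((R - 1 : ℕ) : ℕ∞) := by
      rwa [SimpleGraph.edist_comm]
    unfold priority at he
    rw [if_pos lx, if_pos ly] at he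
    have hcol : rulerColor R (i + 1) H (owner R i H x) = rulerColor R (i + 1) H (owner R i H y) := by
      split_ifs at he <;> omega
    have hown : owner R i H x = owner R i H y := by
      by_contra hne
      refine (rulerColor_spec hH hR).2 _ ox _ oy hne ?_ hcol
      refine (edist_le_add (edist_le_add dx' hd) dy).trans ?_
      exact_mod_cast (by omega : R - 1 + (9 * R - 1) + (R - 1) ≤ 12 * R)
    have hysec : IsSecond R i H y := by
      refine ⟨x, hxy, ⟨hx, ?_⟩, hown⟩
      rw [hown, SimpleGraph.edist_comm] at dx
      refine (edist_le_add dy dx).trans ?_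
      exact_mod_cast (by omega : R - 1 + (R - 1) ≤ 2 * R)
    -- Equal priorities make `x` second as well, which produces a third new vertex `z` with this
    -- owner. Three points pairwise `R` apart do not fit in an interval of length `2 * (R - 1)`.
    have hxsec : IsSecond R i H x := by
      by_contra hns
      rw [if_neg hns, if_pos hysec, hcol] at he
      omega
    obtain ⟨z, hzx, ⟨hz, -⟩, hzo⟩ := hxsec
    have lz := logStar_eq_of_mem_newSet hH hR hz
    have dz' : H.edist (owner R i H z) z ≤ ((R - 1 : ℕ) : ℕ∞) := by
      rw [SimpleGraph.edist_comm]; exact (owner_spec hH hR lz).2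
    rw [hzo] at dz'
    rw [← hown] at dy'
    have hpack := ((esSet_isSetTrace hH).isLimitedRulingSet hH hR Function.injective_id
      (i + 1)).packing
    have pxy := hpack x hx.1 y hy.1 (by omega)
    have pxz := hpack x hx.1 z hz.1 (by omega)
    have pyz := hpack y hy.1 z hz.1 (by omega)
    obtain ⟨pos, hpos⟩ := hH (owner R i H x)
    have fin : ∀ w, H.edist (owner R i H x) w ≤ ((R - 1 : ℕ) : ℕ∞) →
        H.edist (owner R i H x) w ≠ ⊤ := fun w hw =>
      ne_top_of_le_ne_top (ENat.natCast_ne_top _) hw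
    have fo : H.edist (owner R i H x) (owner R i H x) ≠ ⊤ := by simp
    rw [hpos _ _ (fin _ dx') (fin _ dy')] at pxy
    rw [hpos _ _ (fin _ dx') (fin _ dz')] at pxz
    rw [hpos _ _ (fin _ dy') (fin _ dz')] at pyz
    have ex := hpos _ _ fo (fin _ dx')
    have ey := hpos _ _ fo (fin _ dy')
    have ez := hpos _ _ fo (fin _ dz')
    rw [ex] at dx'
    rw [ey] at dy'
    rw [ez] at dz'
    norm_cast at pxy pxz pyz dx' dy' dz'
    omega
  rcases lt_or_gt_of_ne hxy with h | h
  · exact key x hx y hy h hd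
  · exact (key y hy x hx h (by rwa [SimpleGraph.edist_comm])).symm

variable {χ : SimpleGraph ℕ → ℕ → Fin 17}

theorem extendColor_of_notMem {x : ℕ} (hx : x ∉ newSet R i H) (q : ℕ) :
    extendColor R i χ q H x = χ H x := by
  induction q with
  | zero => rfl
  | succ q ih => rw [extendColor, if_neg fun h => hx h.1, ih]

theorem extendColor_of_priority_lt {x q : ℕ} (hq : priority R i H x < q) :
    extendColor R i χ q H x = extendColor R i χ (priority R i H x + 1) H x := by
  induction q, hq using Nat.le_induction with
  | base => rfl
  | succ q hq ih =>
    rw [extendColor, if_neg (fun h => ?_), ih]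
    have := h.2
    omega

/-- The color of a new vertex differs from the colors of all nearby old vertices and of all nearby
new vertices with smaller priority. -/
theorem extendColor_ne (hH : LineMetric H) (hR : 1 ≤ R) {x w Q : ℕ} (hx : x ∈ newSet R i H)
    (hw : w ∈ esSet R (i + 1) H) (hwx : w ≠ x) (hd : H.edist x w ≤ (9 * R - 1 : ℕ))
    (hlow : w ∈ esSet R i H ∨ priority R i H w < priority R i H x)
    (hQ : priority R i H x < Q) :
    extendColor R i χ Q H x ≠ extendColor R i χ Q H w := by
  set p := priority R i H x with hp
  have hpack := ((esSet_isSetTrace hH).isLimitedRulingSet hH hR Function.injective_id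
    (i + 1)).packing
  -- As `9 * R - 1 < (8 + 1) * R`, at most `2 * 8` other members can block a color, one fewer than
  -- the 17 available.
  obtain ⟨hf, hc⟩ := hH.ncard_packing_le (q := 8) (k := 9 * R - 1) hR hpack (by omega) hx.1
  have hused : (usedColors R i p (extendColor R i χ p H) H x).ncard ≤ 16 := by
    refine (Set.ncard_le_ncard (t := extendColor R i χ p H ''
      {y ∈ esSet R (i + 1) H | y ≠ x ∧ H.edist x y ≤ (9 * R - 1 : ℕ)}) ?_ (hf.image _)).trans
      ((Set.ncard_image_le hf).trans hc)
    rintro a ⟨w, h1, ⟨h2, h3⟩, -, rfl⟩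
    exact ⟨w, ⟨h2, h1, h3⟩, rfl⟩
  have hxc : extendColor R i χ Q H x =
      freeColor (usedColors R i p (extendColor R i χ p H) H x) := by
    rw [extendColor_of_priority_lt hQ, ← hp, extendColor, if_pos ⟨hx, rfl⟩]
  have hwc : extendColor R i χ Q H w = extendColor R i χ p H w := by
    by_cases hwn : w ∈ newSet R i H
    · have hlow' := hlow.resolve_left hwn.2
      rw [extendColor_of_priority_lt (hlow'.trans hQ), extendColor_of_priority_lt hlow']
    · rw [extendColor_of_notMem hwn, extendColor_of_notMem hwn]
  rw [hxc, hwc]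
  intro he
  exact freeColor_notMem hused ⟨w, hwx, ⟨hw, hd⟩, hlow, he.symm⟩

theorem esColor_eq (hH : LineMetric H) (hR : 1 ≤ R) {x : ℕ} (hi : logStar x ≤ i) :
    esColor R i H x = esColor R (logStar x) H x := by
  induction i with
  | zero => have := one_le_logStar x; omega
  | succ i ih =>
    rcases Nat.lt_or_ge i (logStar (x : ℝ)) with h | h
    · rw [show logStar (x : ℝ) = i + 1 by omega]
    · rw [← ih h, esColor, extendColor_of_notMem]
      intro hx
      have := logStar_eq_of_mem_newSet hH hR hx
      omega

/-- The sets and colors defined above form a trace of `ES-ColPathRulingSet`. -/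
theorem esSet_isESColTrace (hH : LineMetric H) (hR : 1 ≤ R) :
    IsESColTrace H id R (fun i => esSet R i H) (fun x => esColor R (logStar x) H x) where
  start := rfl
  extend := (esSet_isSetTrace hH).extend
  color i hi := by
    obtain ⟨i, rfl⟩ : ∃ j, i = j + 1 := ⟨i - 1, by omega⟩
    rw [Nat.add_sub_cancel]
    have hcol : ∀ x ∈ esSet R (i + 1) H, esColor R (logStar x) H x =
        extendColor R i (esColor R i) (2 * paletteSize) H x := fun x hx =>
      (esColor_eq hH hR (((esSet_isSetTrace hH).isLimitedRulingSet hH hR Function.injective_id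
        (i + 1)).subset hx)).symm
    have hprio : ∀ x ∈ newSet R i H, priority R i H x < 2 * paletteSize := fun x hx =>
      priority_lt hH hR (logStar_eq_of_mem_newSet hH hR hx)
    refine ⟨?_, ?_⟩
    · rintro u hu w ⟨hw, u', hu', hd⟩
      rw [show u' = u from hu'] at hd
      have hw' := (esSet_isSetTrace hH).subset_succ i hw
      rw [hcol u hu.1, hcol w hw']
      exact extendColor_ne hH hR hu hw' (fun h => hu.2 (h ▸ hw))
        (by rwa [SimpleGraph.edist_comm]) (Or.inl hw) (hprio u hu)
    · rintro u hu v hv ⟨huv, hd⟩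
      rw [hcol u hu.1, hcol v hv.1]
      rcases lt_or_gt_of_ne (priority_ne hH hR hu hv huv hd) with h | h
      · exact (extendColor_ne hH hR hv hu.1 huv (by rwa [SimpleGraph.edist_comm]) (Or.inr h)
          (hprio v hv)).symm
      · exact extendColor_ne hH hR hu hv.1 huv.symm hd (Or.inr h) (hprio u hu)

end Spec

section Locality

variable {R i r : ℕ}

theorem owner_isLocal (hP : IsLocalSet r (pathSet R (i + 1))) :
    IsLocal (r + R) (owner R i) := by
  intro H H' hH hH' a ha
  simp only [owner]
  congr 1
  ext p
  exact hP.near_iff hH hH' ha (Nat.sub_le R 1)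

theorem isSecond_isLocal (hN : IsLocalSet r (newSet R i)) (ho : IsLocal r (owner R i)) :
    IsLocal (r + 2 * R) (IsSecond R i) := by
  intro H H' hH hH' a ha
  refine propext (exists_congr fun z => and_congr_right fun _ => ?_)
  rw [← hN.near_iff hH hH' ha le_rfl]
  refine and_congr_right fun hz => ?_
  rw [ho.eq_of_edist_le hH hH' ha hz.2, ho.eq_of_edist_le hH hH' ha (b := a) (by simp)]

theorem priority_isLocal (hR : 1 ≤ R) (hP : IsLocalSet r (pathSet R (i + 1)))
    (hc : IsLocal r (rulerColor R (i + 1))) (hN : IsLocalSet (r + 17 * R) (newSet R i)) :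
    IsLocal (r + 19 * R) (priority R i) := by
  classical
  have ho := owner_isLocal hP
  have hs : IsLocal (r + 19 * R) (IsSecond R i) :=
    (isSecond_isLocal hN (ho.mono (by omega))).mono (by omega)
  intro H H' hH hH' a ha
  unfold priority
  by_cases ha1 : logStar a = i + 1
  · have h1 := hs H H' hH hH' a ha
    have h2 := ho H H' hH hH' a (ha.mono (by omega))
    have h3 : rulerColor R (i + 1) H (owner R i H a) = rulerColor R (i + 1) H' (owner R i H a) :=
      hc.eq_of_edist_le hH hH' (ha.mono (by omega : r + (R - 1) ≤ r + 19 * R))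
        (owner_spec hH hR ha1).2
    rw [if_pos ha1, if_pos ha1, h3, h2, if_congr (iff_of_eq h1) rfl rfl]
  · rw [if_neg ha1, if_neg ha1]

theorem extendColor_isLocal {χ : SimpleGraph ℕ → ℕ → Fin 17} (hχ : IsLocal r χ)
    (hS : IsLocalSet r (esSet R i)) (hS' : IsLocalSet r (esSet R (i + 1)))
    (hp : IsLocal r (priority R i)) (q : ℕ) :
    IsLocal (r + 9 * R * q) (extendColor R i χ q) := by
  classical
  induction q with
  | zero => exact hχ
  | succ q ih =>
    intro H H' hH hH' a ha
    rw [show r + 9 * R * (q + 1) = r + 9 * R * q + 9 * R by ring] at ha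
    have hle : r ≤ r + 9 * R * q := Nat.le_add_right _ _
    have hN : IsLocalSet (r + 9 * R * q) (newSet R i) := IsLocal.mono (hS'.diff hS) hle
    have ha0 : H.edist a a ≤ (9 * R : ℕ) := by simp
    have hused : usedColors R i q (extendColor R i χ q H) H a =
        usedColors R i q (extendColor R i χ q H') H' a := by
      ext c
      refine exists_congr fun w => and_congr_right fun _ => ?_
      rw [← IsLocalSet.near_iff (IsLocal.mono hS' hle) hH hH' ha (Nat.sub_le _ 1)]
      refine and_congr_right fun hw => ?_
      have hd : H.edist a w ≤ (9 * R : ℕ) := hw.2.trans (by exact_mod_cast Nat.sub_le _ 1)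
      rw [ih.eq_of_edist_le hH hH' ha hd, (hp.mono hle).eq_of_edist_le hH hH' ha hd,
        IsLocalSet.mem_iff (IsLocal.mono hS hle) hH hH' ha hd]
    simp only [extendColor]
    rw [hused, ih.eq_of_edist_le hH hH' ha ha0, (hp.mono hle).eq_of_edist_le hH hH' ha ha0]
    exact if_congr (and_congr_left' (hN.mem_iff hH hH' ha ha0)) rfl rfl

/-- The set and the coloring after `i` classes have been treated are local with radius
`O(R i)`. -/
theorem es_isLocal (hR : 1 ≤ R) (i : ℕ) :
    IsLocalSet ((58 + 21 * paletteSize) * R * i) (esSet R i) ∧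
      IsLocal ((58 + 21 * paletteSize) * R * i) (esColor R i) := by
  have hPl := fun j => pathSet_isLocal (i := j) hR
  have hCl := fun j => rulerColor_isLocal (i := j) hR
  have hsucc := esColor_succ R
  generalize paletteSize = Q at *
  induction i with
  | zero => exact ⟨fun _ _ _ _ _ _ => rfl, fun _ _ _ _ _ _ => rfl⟩
  | succ i ih =>
    -- A common bound for the old radius and for that of the ruler coloring, `15 * R * (i + 1) + 24
    -- * R + 3 * Q * R`; the two are not added. Sets and priorities then cost `19 * R` and the `2 *
    -- Q` coloring steps `18 * Q * R`, so the radius grows by `(58 + 21 * Q) * R` per class.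
    set r := (58 + 21 * Q) * R * i + (39 + 3 * Q) * R with hr
    have h1 : (58 + 21 * Q) * R * i ≤ r := by omega
    have h2 : 3 * R * (i + 1 + Q) + 24 * R + 12 * R * (i + 1) ≤ r := by
      rw [hr]; nlinarith [Nat.zero_le (Q * R * i), Nat.zero_le (R * i)]
    have hP : IsLocalSet r (pathSet R (i + 1)) :=
      IsLocal.mono (hPl _) ((Nat.le_add_right _ _).trans h2)
    have hc : IsLocal r (rulerColor R (i + 1)) := (hCl _).mono h2
    have hS : IsLocalSet r (esSet R i) := ih.1.mono h1
    have hS' := esSet_succ_isLocal hR hS hP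
    have hN : IsLocalSet (r + 17 * R) (newSet R i) :=
      IsLocalSet.diff hS' (hS.mono (Nat.le_add_right _ _))
    have hp := priority_isLocal hR hP hc hN
    have hx := extendColor_isLocal (ih.2.mono (h1.trans (Nat.le_add_right _ (19 * R))))
      (hS.mono (Nat.le_add_right _ (19 * R))) (IsLocal.mono hS' (by omega : _ ≤ r + 19 * R))
      hp (2 * Q)
    have hend : r + 19 * R + 9 * R * (2 * Q) = (58 + 21 * Q) * R * (i + 1) := by
      rw [hr]; ring
    rw [hend, ← hsucc] at hx
    refine ⟨IsLocal.mono hS' ?_, hx⟩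
    rw [← hend]
    have := Nat.zero_le (9 * R * (2 * Q))
    omega

end Locality

end LocalColoring

/-! ### Transport between a labeled graph and the graph on its labels. -/

section Transport

theorem enat_eq_of_forall_le_iff {a b : ℕ∞} (h : ∀ n : ℕ, a ≤ n ↔ b ≤ n) : a = b := by
  have key : ∀ a b : ℕ∞, (∀ n : ℕ, a ≤ n ↔ b ≤ n) → a ≤ b := by
    intro a b h
    cases b with
    | top => exact le_top
    | coe n => exact (h n).mpr le_rfl
  exact le_antisymm (key a b h) (key b a fun n => (h n).symm)

variable {V : Type*} {G : SimpleGraph V} {ℓ : V → ℕ}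

/-- The labeled graph, with the vertices replaced by their labels. -/
def labelGraph (G : SimpleGraph V) (ℓ : V → ℕ) (hℓ : Function.Injective ℓ) : SimpleGraph ℕ where
  Adj a b := ∃ u w, G.Adj u w ∧ ℓ u = a ∧ ℓ w = b
  symm := ⟨fun _ _ ⟨u, w, h, hu, hw⟩ => ⟨w, u, h.symm, hw, hu⟩⟩
  loopless := ⟨fun _ ⟨_, _, h, hu, hw⟩ => h.ne (hℓ (hu.trans hw.symm))⟩

variable (hℓ : Function.Injective ℓ)

theorem labelGraph_adj {v : V} {x : ℕ} :
    (labelGraph G ℓ hℓ).Adj (ℓ v) x ↔ ∃ w, ℓ w = x ∧ G.Adj v w := by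
  constructor
  · rintro ⟨u, w, h, h1, rfl⟩
    exact ⟨w, rfl, hℓ h1 ▸ h⟩
  · rintro ⟨w, rfl, h⟩
    exact ⟨v, w, h, rfl, rfl⟩

theorem labelGraph_edist_le {v : V} {x n : ℕ} :
    (labelGraph G ℓ hℓ).edist (ℓ v) x ≤ n ↔ ∃ w, ℓ w = x ∧ G.edist v w ≤ n := by
  induction n generalizing v with
  | zero => simp
  | succ n ih =>
    rw [edist_le_succ_iff]
    simp only [edist_le_succ_iff, labelGraph_adj hℓ]
    constructor
    · rintro (rfl | ⟨_, ⟨y, rfl, hy⟩, h⟩)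
      · exact ⟨v, rfl, Or.inl rfl⟩
      · obtain ⟨w, hw, h⟩ := ih.mp h
        exact ⟨w, hw, Or.inr ⟨y, hy, h⟩⟩
    · rintro ⟨w, rfl, (rfl | ⟨y, hy, h⟩)⟩
      · exact Or.inl rfl
      · exact Or.inr ⟨ℓ y, ⟨y, rfl, hy⟩, ih.mpr ⟨w, rfl, h⟩⟩

theorem labelGraph_edist {v w : V} :
    (labelGraph G ℓ hℓ).edist (ℓ v) (ℓ w) = G.edist v w := by
  refine enat_eq_of_forall_le_iff fun n => ?_
  rw [labelGraph_edist_le hℓ]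
  constructor
  · rintro ⟨w', h, hd⟩; rwa [← hℓ h]
  · exact fun h => ⟨w, rfl, h⟩

theorem exists_label_of_edist_ne_top {v : V} {x : ℕ}
    (h : (labelGraph G ℓ hℓ).edist (ℓ v) x ≠ ⊤) : ∃ w, ℓ w = x := by
  obtain ⟨n, hn⟩ := ENat.ne_top_iff_exists.mp h
  obtain ⟨w, hw, -⟩ := (labelGraph_edist_le hℓ).mp hn.ge
  exact ⟨w, hw⟩

/-- Numbers that are not labels become isolated vertices. This is why `LineMetric` speaks of
components and does not ask them to be infinite. -/
theorem labelGraph_lineMetric (hG : LineMetric G) : LineMetric (labelGraph G ℓ hℓ) := by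
  intro a
  by_cases ha : ∃ v, ℓ v = a
  · obtain ⟨v, rfl⟩ := ha
    obtain ⟨pos, hpos⟩ := hG v
    have : Nonempty V := ⟨v⟩
    refine ⟨fun x => pos (Function.invFun ℓ x), fun x y hx hy => ?_⟩
    obtain ⟨u, rfl⟩ := exists_label_of_edist_ne_top hℓ hx
    obtain ⟨w, rfl⟩ := exists_label_of_edist_ne_top hℓ hy
    rw [labelGraph_edist hℓ] at hx hy ⊢
    simp only
    rw [Function.leftInverse_invFun hℓ u, Function.leftInverse_invFun hℓ w]
    exact hpos u w hx hy
  · have hiso : ∀ x, (labelGraph G ℓ hℓ).edist a x ≠ ⊤ → a = x := by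
      intro x hx
      rw [SimpleGraph.edist_ne_top_iff_reachable] at hx
      obtain ⟨p⟩ := hx
      cases p with
      | nil => rfl
      | cons h q =>
        obtain ⟨u, w, _, hu, _⟩ := h
        exact absurd ⟨u, hu⟩ ha
    refine ⟨fun _ => 0, fun x y hx hy => ?_⟩
    rw [← hiso x hx, ← hiso y hy]; simp

theorem distToSet_preimage {S : Set ℕ} {v : V} :
    distToSet G (ℓ ⁻¹' S) v = distToSet (labelGraph G ℓ hℓ) S (ℓ v) := by
  refine enat_eq_of_forall_le_iff fun n => ?_
  rw [distToSet_le_iff, distToSet_le_iff]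
  constructor
  · rintro ⟨s, hs, hd⟩
    exact ⟨ℓ s, hs, by rwa [labelGraph_edist hℓ]⟩
  · rintro ⟨s, hs, hd⟩
    obtain ⟨w, rfl, hd'⟩ := (labelGraph_edist_le hℓ).mp hd
    exact ⟨w, hs, hd'⟩

theorem neighborhood_preimage {k : ℕ} {S : Set ℕ} :
    neighborhood G k (ℓ ⁻¹' S) = ℓ ⁻¹' neighborhood (labelGraph G ℓ hℓ) k S := by
  ext v
  have h := distToSet_preimage (G := G) hℓ (S := S) (v := v)
  change (∃ u ∈ ℓ ⁻¹' S, G.edist v u ≤ k) ↔ ∃ u ∈ S, (labelGraph G ℓ hℓ).edist (ℓ v) u ≤ k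
  rw [← distToSet_le_iff, ← distToSet_le_iff, h]

theorem candidates_preimage {R : ℕ} {U S : Set ℕ} :
    candidates G (ℓ ⁻¹' U) R (ℓ ⁻¹' S) = ℓ ⁻¹' candidates (labelGraph G ℓ hℓ) U R S := by
  ext v
  change (ℓ v ∈ U ∧ _) ↔ (ℓ v ∈ U ∧ _)
  rw [distToSet_preimage hℓ]

theorem greedyStep_preimage {R : ℕ} {U S : Set ℕ} :
    greedyStep G ℓ (ℓ ⁻¹' U) R (ℓ ⁻¹' S) =
      ℓ ⁻¹' greedyStep (labelGraph G ℓ hℓ) id U R S := by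
  ext v
  refine or_congr Iff.rfl (and_congr ?_ ?_)
  · rw [candidates_preimage hℓ]; rfl
  · rw [candidates_preimage hℓ]
    simp only [distToSet_preimage hℓ, id]
    constructor
    · intro h x hx hne hd
      obtain ⟨u, rfl, hd'⟩ := (labelGraph_edist_le hℓ).mp hd
      exact h u hx (fun e => hne (e ▸ rfl)) hd'
    · intro h u hu hne hd
      exact h (ℓ u) hu (fun e => hne (hℓ e)) (by rwa [labelGraph_edist hℓ])

theorem greedyStep_iterate_preimage {R : ℕ} {U S : Set ℕ} (n : ℕ) :
    (greedyStep G ℓ (ℓ ⁻¹' U) R)^[n] (ℓ ⁻¹' S) =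
      ℓ ⁻¹' (greedyStep (labelGraph G ℓ hℓ) id U R)^[n] S := by
  induction n with
  | zero => rfl
  | succ n ih =>
    rw [Function.iterate_succ_apply', Function.iterate_succ_apply', ih, greedyStep_preimage hℓ]

theorem powerGraph_adj_preimage {k : ℕ} {v w : V} :
    (powerGraph G k).Adj v w ↔ (powerGraph (labelGraph G ℓ hℓ) k).Adj (ℓ v) (ℓ w) := by
  change (_ ∧ _) ↔ (_ ∧ _)
  rw [labelGraph_edist hℓ, hℓ.ne_iff]

theorem IsMISOn.preimage {k : ℕ} {U S : Set ℕ}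
    (h : IsMISOn (powerGraph (labelGraph G ℓ hℓ) k) U S) :
    IsMISOn (powerGraph G k) (ℓ ⁻¹' U) (ℓ ⁻¹' S) where
  subset _ hv := h.subset hv
  independent u hu v hv hadj :=
    h.independent (ℓ u) hu (ℓ v) hv ((powerGraph_adj_preimage hℓ).mp hadj)
  dominating u hu hu' := by
    obtain ⟨x, hx, hadj⟩ := h.dominating (ℓ u) hu hu'
    obtain ⟨w, rfl, -⟩ := (labelGraph_edist_le hℓ).mp hadj.2
    exact ⟨w, hx, (powerGraph_adj_preimage hℓ).mpr hadj⟩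

theorem IsPathRulingSetResult.preimage {R i : ℕ} {P : Set ℕ}
    (h : IsPathRulingSetResult (labelGraph G ℓ hℓ) id (labelClass id i) R P) :
    IsPathRulingSetResult G ℓ (labelClass ℓ i) R (ℓ ⁻¹' P) := by
  obtain ⟨M, h0, hM, rfl⟩ := h
  refine ⟨fun j => ℓ ⁻¹' M j, ?_, fun j h1 h2 => (hM j h1 h2).preimage hℓ, ?_⟩
  · simp only [h0]; rfl
  · exact (greedyStep_iterate_preimage hℓ 6).symm

theorem IsESColTrace.preimage {R : ℕ} {S : ℕ → Set ℕ} {χ : ℕ → Fin 17}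
    (h : IsESColTrace (labelGraph G ℓ hℓ) id R S χ) :
    IsESColTrace G ℓ R (fun i => ℓ ⁻¹' S i) (fun v => χ (ℓ v)) where
  start := by simp only [h.start, Set.preimage_empty]
  extend i hi := by
    obtain ⟨P, hP, hS⟩ := h.extend i hi
    refine ⟨ℓ ⁻¹' P, hP.preimage hℓ, ?_⟩
    rw [hS, neighborhood_preimage hℓ]
    exact (greedyStep_iterate_preimage hℓ 4).symm
  color i hi := by
    have hc := h.color i hi
    refine ⟨fun u hu w hw => ?_, fun u hu v hv hadj => ?_⟩
    · obtain ⟨hw1, u', hu', hd⟩ := hw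
      refine hc.mem_list (ℓ u) hu (ℓ w) ⟨hw1, ℓ u, rfl, ?_⟩
      rw [show u' = u from hu'] at hd
      rwa [labelGraph_edist hℓ]
    · exact hc.proper (ℓ u) hu (ℓ v) hv ((powerGraph_adj_preimage hℓ).mp hadj)

theorem committedOutput_preimage {R : ℕ} {S : Set ℕ} {χ : ℕ → Fin 17} {v : V} :
    committedOutput G ℓ R (ℓ ⁻¹' S) (fun v => χ (ℓ v)) v =
      committedOutput (labelGraph G ℓ hℓ) id R S χ (ℓ v) := by
  unfold committedOutput
  congr 1
  ext p
  constructor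
  · rintro ⟨u, hu, hd, rfl⟩
    exact ⟨ℓ u, hu, by rwa [labelGraph_edist hℓ], rfl⟩
  · rintro ⟨x, hx, hd, rfl⟩
    obtain ⟨u, rfl, hd'⟩ := (labelGraph_edist_le hℓ).mp hd
    exact ⟨u, hx, hd', rfl⟩

end Transport

/-! ### The LOCAL algorithm that gathers views. -/

section Algorithm

/-- The output prescribed by `ES-ColPathRulingSet` for the vertex with label `a`. -/
noncomputable def esOutput (R : ℕ) (H : SimpleGraph ℕ) (a : ℕ) : NodeOutput :=
  committedOutput H id R (esSet R (logStar a) H) (fun x => esColor R (logStar x) H x) a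

theorem esOutput_eq_of_agree {R : ℕ} (hR : 1 ≤ R) {H H' : SimpleGraph ℕ} (hH : LineMetric H)
    (hH' : LineMetric H') {a : ℕ}
    (ha : Agree ((59 + 21 * paletteSize) * R * logStar a) a H H') :
    esOutput R H a = esOutput R H' a := by
  classical
  obtain ⟨hS, hχ⟩ := es_isLocal hR (logStar a)
  have hi := one_le_logStar a
  generalize paletteSize = Q at *
  -- The `nearby` list looks up to distance `R - 1` further; this costs one more `R`, hence `59` in
  -- place of `58`.
  have ha' : Agree ((58 + 21 * Q) * R * logStar a + R) a H H' := by
    refine ha.mono ?_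
    have h1 : R ≤ R * logStar (a : ℝ) := Nat.le_mul_of_pos_right R hi
    calc (58 + 21 * Q) * R * logStar (a : ℝ) + R
        ≤ (58 + 21 * Q) * R * logStar (a : ℝ) + R * logStar (a : ℝ) := by omega
      _ = (59 + 21 * Q) * R * logStar (a : ℝ) := by ring
  have hle : ∀ K, LineMetric K → ∀ x ∈ esSet R (logStar a) K,
      esColor R (logStar x) K x = esColor R (logStar a) K x := fun K hK x hx =>
    (esColor_eq hK hR (((esSet_isSetTrace hK).isLimitedRulingSet hK hR Function.injective_id
      _).subset hx)).symm
  have ha0 : H.edist a a ≤ (R : ℕ∞) := by simp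
  unfold esOutput committedOutput
  congr 1
  · have h1 := hS.mem_iff hH hH' ha' ha0
    have h2 := hχ.eq_of_edist_le hH hH' ha' ha0
    exact if_congr h1 (congrArg some h2) rfl
  · ext p
    refine exists_congr fun u => ?_
    rw [← and_assoc, ← and_assoc, ← hS.near_iff hH hH' ha' (Nat.sub_le R 1)]
    refine and_congr_right fun hu => ?_
    have hd : H.edist a u ≤ (R : ℕ∞) := hu.2.trans (by exact_mod_cast Nat.sub_le R 1)
    simp only
    rw [hle H hH u hu.1, hle H' hH' u ((hS.mem_iff hH hH' ha' hd).mp hu.1),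
      hχ.eq_of_edist_le hH hH' ha' hd]

/-- The labeled edges that the vertex with label `a` knows after `t` rounds. -/
def view (H : SimpleGraph ℕ) (t a : ℕ) : Set (ℕ × ℕ) :=
  {p | H.Adj p.1 p.2 ∧ H.edist a p.1 < t}

/-- A view records edges without their distances. By induction the balls of `H` are contained in
those of `H'`, and then the edges of `H'` can be read back as well. -/
theorem agree_of_view_eq {H H' : SimpleGraph ℕ} {t a : ℕ} (h : view H t a = view H' t a) :
    Agree t a H H' := by
  have hmem : ∀ x y, (H.Adj x y ∧ H.edist a x < t) ↔ (H'.Adj x y ∧ H'.edist a x < t) :=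
    fun x y => Set.ext_iff.mp h (x, y)
  have hle : ∀ n : ℕ, n < t → ∀ x, H.edist a x ≤ n → H'.edist a x ≤ n := by
    intro n
    induction n with
    | zero => intro _ x hx; simpa using hx
    | succ n ih =>
      intro hn x hx
      rw [edist_le_succ_iff'] at hx ⊢
      rcases hx with hx | ⟨y, hy, hadj⟩
      · exact Or.inl hx
      · exact Or.inr ⟨y, ih (by omega) y hy,
          ((hmem y x).mp ⟨hadj, hy.trans_lt (by exact_mod_cast (by omega : n < t))⟩).1⟩
  intro x y hx
  constructor
  · exact fun hadj => ((hmem x y).mp ⟨hadj, hx⟩).1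
  · intro hadj
    rcases Nat.eq_zero_or_pos t with rfl | ht
    · simp at hx
    · rw [edist_lt_iff_le_pred ht] at hx
      refine ((hmem x y).mpr ⟨hadj, ?_⟩).1
      rw [edist_lt_iff_le_pred ht]
      exact hle _ (by omega) x hx

/-- This is one round of message exchange. The edges at `v` are added separately because in round 0
a vertex knows only its own label. -/
theorem view_succ {V : Type*} {G : SimpleGraph V} {ℓ : V → ℕ} (hℓ : Function.Injective ℓ)
    (t : ℕ) (v : V) :
    view (labelGraph G ℓ hℓ) (t + 1) (ℓ v) = view (labelGraph G ℓ hℓ) t (ℓ v) ∪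
      {p | ∃ u, G.Adj v u ∧ (p = (ℓ v, ℓ u) ∨ p ∈ view (labelGraph G ℓ hℓ) t (ℓ u))} := by
  have hlt : ∀ a x, (labelGraph G ℓ hℓ).edist a x < ((t + 1 : ℕ) : ℕ∞) ↔
      (labelGraph G ℓ hℓ).edist a x ≤ t := fun a x => edist_lt_iff_le_pred (by omega)
  ext ⟨x, y⟩
  simp only [view, Set.mem_union, Set.mem_ofPred_eq, hlt, Prod.mk.injEq]
  constructor
  · rintro ⟨hadj, hd⟩
    cases t with
    | zero =>
      obtain rfl : ℓ v = x := by simpa using hd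
      obtain ⟨u, rfl, hu⟩ := (labelGraph_adj hℓ).mp hadj
      exact Or.inr ⟨u, hu, Or.inl ⟨rfl, rfl⟩⟩
    | succ t =>
      rcases edist_le_succ_iff.mp hd with rfl | ⟨z, hz, hd'⟩
      · exact Or.inl ⟨hadj, by simp⟩
      · obtain ⟨u, rfl, hu⟩ := (labelGraph_adj hℓ).mp hz
        exact Or.inr ⟨u, hu, Or.inr ⟨hadj, hd'.trans_lt (by exact_mod_cast Nat.lt_succ_self t)⟩⟩
  · rintro (⟨hadj, hd⟩ | ⟨u, hu, (⟨rfl, rfl⟩ | ⟨hadj, hd⟩)⟩)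
    · exact ⟨hadj, hd.le⟩
    · exact ⟨(labelGraph_adj hℓ).mpr ⟨u, rfl, hu⟩, by simp⟩
    · refine ⟨hadj, ?_⟩
      cases t with
      | zero => simp at hd
      | succ t =>
        rw [edist_lt_iff_le_pred (by omega)] at hd
        exact edist_le_succ_iff.mpr
          (Or.inr ⟨ℓ u, (labelGraph_adj hℓ).mpr ⟨u, rfl, hu⟩, hd⟩)

/-- The state of a vertex: the number of rounds, its label, the labeled edges that it knows, and
its output. -/
structure ViewState where
  time : ℕ
  label : ℕ
  edges : Set (ℕ × ℕ)
  out : Option NodeOutput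

open Classical in
/-- The output of a vertex with the given view, computed in any labeled line with this view. -/
noncomputable def viewOutput (R t a : ℕ) (E : Set (ℕ × ℕ)) : NodeOutput :=
  if h : ∃ H, LineMetric H ∧ view H t a = E then esOutput R h.choose a else ⟨none, ∅⟩

/-- `ES-ColPathRulingSet`, in the form that every vertex collects all information within its reach
and a vertex with label `a` computes its output in round `κ R log* a`. -/
noncomputable def esAlgorithm (κ R : ℕ) : LocalAlgorithm NodeOutput where
  State := ViewState
  Msg := ℕ × Set (ℕ × ℕ)
  init a := ⟨0, a, ∅, none⟩
  send s := (s.label, s.edges)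
  step s m :=
    let E := s.edges ∪ {p | ∃ msg ∈ m, p = (s.label, msg.1) ∨ p ∈ msg.2}
    ⟨s.time + 1, s.label, E, s.out.or (if κ * R * logStar s.label ≤ s.time + 1 then
      some (viewOutput R (s.time + 1) s.label E) else none)⟩
  output s := s.out
  commit s m o h := by simp [h]

theorem esAlgorithm_state {V : Type*} {G : SimpleGraph V} [G.LocallyFinite] {ℓ : V → ℕ}
    (hG : LineMetric G) (hℓ : Function.Injective ℓ) {κ R : ℕ} (hκ : 1 ≤ κ) (hR : 1 ≤ R)
    (hloc : ∀ H H', LineMetric H → LineMetric H' → ∀ a : ℕ, Agree (κ * R * logStar a) a H H' →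
      esOutput R H a = esOutput R H' a) (t : ℕ) (v : V) :
    (esAlgorithm κ R).state G ℓ t v = (⟨t, ℓ v, view (labelGraph G ℓ hℓ) t (ℓ v),
      if κ * R * logStar (ℓ v) ≤ t then some (esOutput R (labelGraph G ℓ hℓ) (ℓ v))
      else none⟩ : ViewState) := by
  induction t generalizing v with
  | zero =>
    -- The initial state has no output, so the commit time must be positive.
    have h1 : ¬ κ * R * logStar (ℓ v) ≤ 0 := by
      have := Nat.mul_pos (Nat.mul_pos hκ hR) (one_le_logStar (ℓ v))
      omega
    rw [if_neg h1]
    simp [LocalAlgorithm.state, esAlgorithm, view]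
  | succ t ih =>
    have hstep : ∀ (m : Multiset (ℕ × Set (ℕ × ℕ))) (o : Option NodeOutput),
        view (labelGraph G ℓ hℓ) t (ℓ v) ∪ {p | ∃ msg ∈ m, p = (ℓ v, msg.1) ∨ p ∈ msg.2} =
          view (labelGraph G ℓ hℓ) (t + 1) (ℓ v) →
        (esAlgorithm κ R).step (⟨t, ℓ v, view (labelGraph G ℓ hℓ) t (ℓ v), o⟩ : ViewState) m =
          (⟨t + 1, ℓ v, view (labelGraph G ℓ hℓ) (t + 1) (ℓ v),
            o.or (if κ * R * logStar (ℓ v) ≤ t + 1 then some (viewOutput R (t + 1) (ℓ v)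
              (view (labelGraph G ℓ hℓ) (t + 1) (ℓ v))) else none)⟩ : ViewState) := by
      intro m o h
      rw [← h]
      rfl
    rw [LocalAlgorithm.state, ih v]
    refine (hstep _ _ ?_).trans ?_
    · rw [view_succ]
      congr 1
      ext p
      constructor
      · rintro ⟨msg, hm, hp⟩
        obtain ⟨u, hu, rfl⟩ := Multiset.mem_map.mp hm
        rw [ih u] at hp
        exact ⟨u, (G.mem_neighborFinset v u).mp hu, hp⟩
      · rintro ⟨u, hu, hp⟩
        refine ⟨_, Multiset.mem_map.mpr ⟨u, (G.mem_neighborFinset v u).mpr hu, rfl⟩, ?_⟩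
        rw [ih u]
        exact hp
    congr 1
    by_cases h1 : κ * R * logStar (ℓ v) ≤ t
    · rw [if_pos h1, Option.some_or, if_pos (h1.trans (Nat.le_succ t))]
    · rw [if_neg h1, Option.none_or]
      by_cases h2 : κ * R * logStar (ℓ v) ≤ t + 1
      · rw [if_pos h2, if_pos h2]
        -- The true label graph shows that some line has this view. The chosen line may be another
        -- one, but it agrees with the true one up to the radius that determines the output.
        have hex : ∃ H, LineMetric H ∧ view H (t + 1) (ℓ v) =
            view (labelGraph G ℓ hℓ) (t + 1) (ℓ v) := ⟨_, labelGraph_lineMetric hℓ hG, rfl⟩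
        rw [viewOutput, dif_pos hex]
        congr 1
        exact hloc _ _ hex.choose_spec.1 (labelGraph_lineMetric hℓ hG) _
          ((agree_of_view_eq hex.choose_spec.2).mono h2)
      · rw [if_neg h2, if_neg h2]

theorem esAlgorithm_run {V : Type*} {G : SimpleGraph V} [G.LocallyFinite] {ℓ : V → ℕ}
    (hG : LineMetric G) (hℓ : Function.Injective ℓ) {κ R : ℕ} (hκ : 1 ≤ κ) (hR : 1 ≤ R)
    (hloc : ∀ H H', LineMetric H → LineMetric H' → ∀ a : ℕ, Agree (κ * R * logStar a) a H H' →
      esOutput R H a = esOutput R H' a) (t : ℕ) (v : V) :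
    (esAlgorithm κ R).run G ℓ t v = if κ * R * logStar (ℓ v) ≤ t then
      some (esOutput R (labelGraph G ℓ hℓ) (ℓ v)) else none := by
  rw [LocalAlgorithm.run, esAlgorithm_state hG hℓ hκ hR hloc]
  rfl

end Algorithm

/-! ### Assembly of the two statements. -/

theorem exists_local_implementation :
    ∃ (κ : ℕ) (A : ℕ → LocalAlgorithm NodeOutput) (T : ℕ → ℕ → ℕ),
      ∀ R : ℕ, 1 ≤ R →
        ∀ (V : Type u) (G : SimpleGraph V) [G.LocallyFinite] (ℓ : V → ℕ),
          IsInfiniteLine G → IsLabeling ℓ →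
            IsESColRun G ℓ R (T R) ((A R).run G ℓ) ∧
            ∀ v : V, ∃ t ≤ κ * R * logStar (ℓ v),
              TerminatesInRound ((A R).run G ℓ) v t := by
  obtain ⟨κ, hκ, hloc⟩ : ∃ κ, 1 ≤ κ ∧ ∀ R, 1 ≤ R → ∀ H H', LineMetric H → LineMetric H' → ∀ a : ℕ,
      Agree (κ * R * logStar a) a H H' → esOutput R H a = esOutput R H' a :=
    ⟨59 + 21 * paletteSize, Nat.le_add_right_of_le (by norm_num),
      fun R hR H H' hH hH' a ha => esOutput_eq_of_agree hR hH hH' ha⟩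
  -- Class `i` waits until round `κ * R * i`, which is strictly increasing in `i` because `κ * R` is
  -- positive.
  refine ⟨κ, esAlgorithm κ, fun R i => κ * R * i, fun R hR V G _ ℓ hG hℓ => ?_⟩
  have hrun := esAlgorithm_run hG.lineMetric hℓ.injective hκ hR (hloc R hR)
  refine ⟨⟨fun i j hij => Nat.mul_lt_mul_of_pos_left hij (Nat.mul_pos hκ hR), _, _,
    (esSet_isESColTrace (labelGraph_lineMetric hℓ.injective hG.lineMetric) hR).preimage
      hℓ.injective, fun t v => ?_⟩, fun v => ⟨_, le_rfl, ?_, fun t ht => ?_⟩⟩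
  · rw [hrun]
    exact if_congr Iff.rfl (congrArg some (committedOutput_preimage hℓ.injective).symm) rfl
  · simp [terminatedSet, hrun]
  · simp [terminatedSet, hrun, ht]

theorem mainTheorem4 :
    -- `ES-ColPathRulingSet` has a LOCAL implementation in which `v` terminates within
    -- `κ R log* ℓ(v)` rounds, for a universal constant `κ`
    (∃ (κ : ℕ) (A : ℕ → LocalAlgorithm NodeOutput) (T : ℕ → ℕ → ℕ),
      ∀ R : ℕ, 1 ≤ R →
        ∀ (V : Type u) (G : SimpleGraph V) [G.LocallyFinite] (ℓ : V → ℕ),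
          IsInfiniteLine G → IsLabeling ℓ →
            IsESColRun G ℓ R (T R) ((A R).run G ℓ) ∧
            ∀ v : V, ∃ t ≤ κ * R * logStar (ℓ v),
              TerminatesInRound ((A R).run G ℓ) v t) ∧
    -- every run, whatever maximal independent sets, list colorings and schedule it uses, has
    -- the claimed properties in every round
    (∀ R : ℕ, 1 ≤ R →
      ∀ (V : Type u) (G : SimpleGraph V) [G.LocallyFinite] (ℓ : V → ℕ),
        IsInfiniteLine G → IsLabeling ℓ →
          ∀ (T : ℕ → ℕ) (out : ℕ → V → Option NodeOutput), IsESColRun G ℓ R T out →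
            ∀ t : ℕ,
              IsLimitedRulingSet G (terminatedSet out t) (joinedSet out t) R (R - 1) ∧
              (∃ χ : ((powerGraph G (9 * R - 1)).induce (joinedSet out t)).Coloring (Fin 17),
                ∀ v : joinedSet out t, colorAt out t v = some (χ v)) ∧
              (∀ v : V, TerminatesInRound out v t → ∃ o : NodeOutput, out t v = some o ∧
                ∀ (a : ℕ) (c : Fin 17), (a, c) ∈ o.nearby ↔
                  ∃ u ∈ joinedSet out t, G.edist v u < R ∧ ℓ u = a ∧
                    colorAt out t u = some c)) := by
  exact ⟨exists_local_implementation, fun R hR V G _ ℓ hG hℓ T out h t =>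
    h.correct hG.lineMetric hR hℓ.injective t⟩
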